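/- Let $n\ge 2$, let $D\subset\mathbb R^n$ be bounded and open, and let $(\Omega,\mathcal H,\mathbb P)$ be a probability space. Let $q$ be a Gaussian generalized random function on $\mathbb R^n$: each realization $q(\omega)$ is a linear functional on $C_0^\infty(\mathbb R^n;\mathbb R)$; each $\langle q,\phi\rangle$ is a random variable; all finite linear combinations of such variables are (possibly degenerate) Gaussian; and for every compact $A\subset\mathbb R^n$ there are $N\in\mathbb N$ and a random variable $C\ge 0$ with $\mathbb E C^2<\infty$ such that, almost surely, $|\langle q,\phi\rangle|\le C\sum_{|\alpha|\le N}\sup|\partial^\alpha\phi|$ for all $\phi\in C_0^\infty(\mathbb R^n;\mathbb R)$ supported in $A$. Suppose that $q$ is microlocally isotropic of order $-m$ in $D$ with local strength $\mu$, that is: * $\mathbb E q$ is (given by) a smooth function (in particular $\mathbb E q=0$ is allowed); * $\operatorname{supp} q\subset D$ almost surely; * $n-1<m\le n+1$, and the covariance operator $C_q$, $\langle C_q\phi,\psi\rangle=\operatorname{Cov}(\langle q,\phi\rangle,\langle q,\psi\rangle)$, is a classical pseudodifferential operator of order $-m$ with principal symbol $\mu(x)|\xi|^{-m}$, where $\mu\in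 C_0^\infty(\mathbb R^n;\mathbb R)$, $\operatorname{supp}\mu\subset D$ and $\mu\ge 0$. For $k>0$ and $\theta\in\mathbb S^{n-1}$ let $$u_1^\infty(k,\theta,-\theta)=c_n\int_{\mathbb R^n}e^{ik\theta\cdot y}\,q(y)\,e^{ik\theta\cdot y}\,dy=c_n\langle q,e^{2ik\theta\cdot y}\rangle$$ be the single backscattering far-field pattern, where $c_n\in\mathbb C$ is the normalizing constant of the far-field pattern and the pairing is that of a compactly supported distribution with a smooth function. Write $\widehat\mu(\xi)=(2\pi)^{-n/2}\int_{\mathbb R^n}e^{-i\xi\cdot x}\mu(x)\,dx$. Then for each fixed $\tau\ge 0$ and $\theta\in\mathbb S^{n-1}$, almost surely, $$\lim_{K\to\infty}\frac1K\int_K^{2K}k^m\,u_1^\infty(k,\theta,-\theta)\,\overline{u_1^\infty(k+\tau,\theta,-\theta)}\,dk=c_{n,m}\,\widehat\mu(2\tau\theta),\qquad c_{n,m}=|c_n|^2\,2^{-m}(2\pi)^{n/2},$$ the integrals on the left being absolutely convergent for every $K>0$. -/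

import Mathlib

open MeasureTheory ProbabilityTheory Filter Topology Set TopologicalSpace
open scoped Distributions

noncomputable section

/-- The Euclidean space `ℝⁿ`. -/
abbrev Rn (n : ℕ) : Type := EuclideanSpace ℝ (Fin n)

/-- Real test functions `C₀^∞(ℝⁿ; ℝ)`. -/
abbrev RealTest (n : ℕ) : Type := TestFunction (⊤ : Opens (Rn n)) ℝ ⊤

/-- Complex test functions `C₀^∞(ℝⁿ)`. -/
abbrev ComplexTest (n : ℕ) : Type := TestFunction (⊤ : Opens (Rn n)) ℂ ⊤

/-! ### Generalized random functions -/

/-- A generalized random function: every realization `q ω` is a linear functional on real test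
functions, `⟨q, φ⟩` is a random variable for every `φ`, and on every compact set `K` the
realizations are almost surely bounded by a `C^N` norm times a square integrable random
variable. -/
structure IsGeneralizedRandomFunction {n : ℕ} {Ω : Type*} [MeasurableSpace Ω] (P : Measure Ω)
    (q : Ω → RealTest n →ₗ[ℝ] ℝ) : Prop where
  measurable_apply : ∀ φ : RealTest n, Measurable (fun ω => q ω φ)
  bound : ∀ K : Set (Rn n), IsCompact K →
    ∃ (C : Ω → ℝ) (N : ℕ), Measurable C ∧ (∀ ω, 0 ≤ C ω) ∧ MemLp C 2 P ∧
      ∀ᵐ ω ∂P, ∀ φ : RealTest n, tsupport φ ⊆ K →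
        |q ω φ| ≤ C ω * ∑ i ∈ Finset.range (N + 1), ⨆ x, ‖iteratedFDeriv ℝ i φ x‖

/-- A Gaussian generalized random function: all finite linear combinations of the random
variables `⟨q, φ⟩` have a (possibly degenerate) Gaussian law. -/
structure IsGaussianGeneralizedRandomFunction {n : ℕ} {Ω : Type*} [MeasurableSpace Ω]
    (P : Measure Ω) (q : Ω → RealTest n →ₗ[ℝ] ℝ) : Prop
    extends IsGeneralizedRandomFunction P q where
  gaussian : IsGaussianProcess (fun (φ : RealTest n) ω => q ω φ) P

/-! ### Symbols and pseudodifferential operators -/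

/-- The estimates `|∂_x^α ∂_ξ^β a(x, ξ)| ≤ C_{αβ} (1 + |ξ|)^{d - |β|}` for all `x` and
all `ξ ∈ S`. -/
def SymbolEstimates {n : ℕ} (d : ℝ) (S : Set (Rn n)) (a : Rn n → Rn n → ℂ) : Prop :=
  ∀ i j : ℕ, ∃ C : ℝ, ∀ x : Rn n, ∀ ξ ∈ S,
    ‖iteratedFDeriv ℝ i (fun x' => iteratedFDeriv ℝ j (a x') ξ) x‖ ≤
      C * (1 + ‖ξ‖) ^ (d - (j : ℝ))

/-- Classical (polyhomogeneous) symbols of order `d` on `ℝⁿ × ℝⁿ`: smooth functions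
`a ∈ S^d` with an asymptotic expansion `a ∼ ∑_j p_j`, where `p_j` is smooth for `ξ ≠ 0` and
positively homogeneous of degree `d - j` in `ξ`. -/
structure IsClassicalSymbol {n : ℕ} (d : ℝ) (a : Rn n → Rn n → ℂ) : Prop where
  smooth : ContDiff ℝ (⊤ : ℕ∞) (fun z : Rn n × Rn n => a z.1 z.2)
  estimates : SymbolEstimates d univ a
  expansion : ∃ p : ℕ → Rn n → Rn n → ℂ,
    (∀ j, ContDiffOn ℝ (⊤ : ℕ∞) (fun z : Rn n × Rn n => p j z.1 z.2) {z | z.2 ≠ 0}) ∧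
    (∀ j x ξ, ξ ≠ 0 → ∀ t : ℝ, 0 < t →
      p j x (t • ξ) = ((t ^ (d - (j : ℝ)) : ℝ) : ℂ) * p j x ξ) ∧
    ∀ N : ℕ, SymbolEstimates (d - (N : ℝ)) {ξ | 1 ≤ ‖ξ‖}
      (fun x ξ => a x ξ - ∑ j ∈ Finset.range N, p j x ξ)

/-- The function `σ`, homogeneous of degree `d` in `ξ`, is a principal symbol of `a`: the
difference satisfies the estimates of order `d - 1` for `|ξ| ≥ 1`. -/
def HasPrincipalSymbol {n : ℕ} (d : ℝ) (a σ : Rn n → Rn n → ℂ) : Prop :=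
  SymbolEstimates (d - 1) {ξ | 1 ≤ ‖ξ‖} (fun x ξ => a x ξ - σ x ξ)

/-- The operator with symbol `a`:
`(2π)^{-n} ∫ ∫ e^{i (x - y)·ξ} a(x, ξ) φ(y) dy dξ`. -/
def pseudoDiffOp {n : ℕ} (a : Rn n → Rn n → ℂ) (φ : RealTest n) (x : Rn n) : ℂ :=
  (((2 * Real.pi) ^ n : ℝ) : ℂ)⁻¹ *
    ∫ ξ : Rn n, ∫ y : Rn n,
      Complex.exp (Complex.I * ((inner ℝ (x - y) ξ : ℝ) : ℂ)) * a x ξ * ((φ y : ℝ) : ℂ)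

/-- The covariance operator of `q`, `⟨C_q φ, ψ⟩ = Cov(⟨q, φ⟩, ⟨q, ψ⟩)`, is the
pseudodifferential operator with symbol `a`. -/
def HasCovarianceSymbol {n : ℕ} {Ω : Type*} [MeasurableSpace Ω] (P : Measure Ω)
    (q : Ω → RealTest n →ₗ[ℝ] ℝ) (a : Rn n → Rn n → ℂ) : Prop :=
  ∀ φ ψ : RealTest n,
    ((covariance (fun ω => q ω φ) (fun ω => q ω ψ) P : ℝ) : ℂ) =
      ∫ x : Rn n, pseudoDiffOp a φ x * ((ψ x : ℝ) : ℂ)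

/-! ### Microlocally isotropic fields -/

/-- `q` is microlocally isotropic of order `-m` in `D`, with local strength `μ`. -/
structure IsMicrolocallyIsotropic {n : ℕ} {Ω : Type*} [MeasurableSpace Ω] (P : Measure Ω)
    (q : Ω → RealTest n →ₗ[ℝ] ℝ) (D : Set (Rn n)) (m : ℝ) (μ : Rn n → ℝ) : Prop where
  /-- The mean `φ ↦ 𝔼⟨q, φ⟩` is a smooth function. -/
  mean_smooth : ∃ f : Rn n → ℝ, ContDiff ℝ (⊤ : ℕ∞) f ∧
    ∀ φ : RealTest n, ∫ ω, q ω φ ∂P = ∫ x, f x * φ x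
  /-- The realizations are almost surely supported in `D`. -/
  support_subset : ∀ᵐ ω ∂P, Distribution.dsupport (fun φ : RealTest n => q ω φ) ⊆ D
  lt_order : (n : ℝ) - 1 < m
  order_le : m ≤ (n : ℝ) + 1
  strength_smooth : ContDiff ℝ (⊤ : ℕ∞) μ
  strength_compact : HasCompactSupport μ
  strength_support : tsupport μ ⊆ D
  strength_nonneg : ∀ x, 0 ≤ μ x
  /-- The covariance operator is a classical pseudodifferential operator of order `-m` with
  principal symbol `μ(x) |ξ|^{-m}`. -/
  covariance_symbol : ∃ a : Rn n → Rn n → ℂ,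
    IsClassicalSymbol (-m) a ∧
    HasPrincipalSymbol (-m) a (fun x ξ => ((μ x * ‖ξ‖ ^ (-m) : ℝ) : ℂ)) ∧
    HasCovarianceSymbol P q a

/-! ### Single scattering -/

/-- The extension `⟨T, φ⟩ = ⟨T, Re φ⟩ + i ⟨T, Im φ⟩` to complex test functions. -/
def complexPairing {n : ℕ} (T : RealTest n →ₗ[ℝ] ℝ) (φ : ComplexTest n) : ℂ :=
  ((T (TestFunction.postcompCLM Complex.reCLM φ) : ℝ) : ℂ) +
    Complex.I * ((T (TestFunction.postcompCLM Complex.imCLM φ) : ℝ) : ℂ)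

/-- The complex test function `χ f`, for `f` smooth. -/
def cutoffMul {n : ℕ} (χ : RealTest n) (f : Rn n → ℂ) (hf : ContDiff ℝ (⊤ : ℕ∞) f) :
    ComplexTest n where
  toFun y := χ y • f y
  contDiff' := χ.contDiff.smul hf
  hasCompactSupport' := χ.hasCompactSupport.smul_right
  tsupport_subset' := fun _ _ => trivial

/-- The plane wave `e^{i k θ·y}`. -/
def planeWave {n : ℕ} (k : ℝ) (θ : Rn n) (y : Rn n) : ℂ :=
  Complex.exp (Complex.I * (k : ℂ) * ((inner ℝ θ y : ℝ) : ℂ))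

theorem contDiff_planeWave {n : ℕ} (k : ℝ) (θ : Rn n) : ContDiff ℝ (⊤ : ℕ∞) (planeWave k θ) := by
  unfold planeWave
  have h : ContDiff ℝ (⊤ : ℕ∞) (fun y : Rn n => ((inner ℝ θ y : ℝ) : ℂ)) :=
    Complex.ofRealCLM.contDiff.comp (contDiff_const.inner ℝ contDiff_id)
  exact (contDiff_const.mul h).cexp

/-- The far-field pattern of the first term of the Born series, at wavenumber `k`, incident
direction `θ` and observation direction `ϑ`:
`u₁^∞(k, θ, ϑ) = c ∫ e^{-i k ϑ·y} V(y) u₀(y) dy`, with `u₀(y) = e^{i k θ·y}`.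
The integral is the pairing of the compactly supported distribution `V` with a smooth function,
computed as `⟨V, χ e^{-i k ϑ·y} u₀⟩` with `χ ∈ C₀^∞` equal to `1` on an open set containing the
support of `V`; it does not depend on `χ`. -/
def singleScatteringFarField {n : ℕ} (c : ℂ) (V : RealTest n →ₗ[ℝ] ℝ) (χ : RealTest n)
    (k : ℝ) (θ ϑ : Rn n) : ℂ :=
  c * complexPairing V
    (cutoffMul χ (fun y => planeWave k (-ϑ) y * planeWave k θ y)
      ((contDiff_planeWave k (-ϑ)).mul (contDiff_planeWave k θ)))

/-- The unitary Fourier transform `(2π)^{-n/2} ∫ e^{-i ξ·x} f(x) dx`. -/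
def unitaryFourier {n : ℕ} (f : Rn n → ℝ) (ξ : Rn n) : ℂ :=
  (((2 * Real.pi) ^ (-((n : ℝ) / 2)) : ℝ) : ℂ) *
    ∫ x : Rn n, Complex.exp (-(Complex.I * ((inner ℝ ξ x : ℝ) : ℂ))) * ((f x : ℝ) : ℂ)

/-- The constant `c_{n,m} = |c|² 2^{-m} (2π)^{n/2}`, where `c = c_n` is the normalizing constant
of the far-field pattern. -/
def backscatteringConst (c : ℂ) (n : ℕ) (m : ℝ) : ℝ :=
  ‖c‖ ^ 2 * (2 : ℝ) ^ (-m) * (2 * Real.pi) ^ ((n : ℝ) / 2)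

/-- The correlation `k^m u₁^∞(k, θ, -θ) conj(u₁^∞(k + τ, θ, -θ))` of the single backscattering
at two frequencies. -/
def backscatteringCorrelation {n : ℕ} (c : ℂ) (V : RealTest n →ₗ[ℝ] ℝ) (χ : RealTest n) (m τ : ℝ)
    (θ : Rn n) (k : ℝ) : ℂ :=
  ((k ^ m : ℝ) : ℂ) * singleScatteringFarField c V χ k θ (-θ) *
    (starRingEnd ℂ) (singleScatteringFarField c V χ (k + τ) θ (-θ))

end

/-! ### Fourth moments of Gaussian variables -/

/-! For fixed `θ`, the backscattering data at wavenumber `k` is `c (X_k + i Y_k)`, where `X_k` and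
`Y_k` are the pairings of `q` with `χ cos(2kθ·y)` and `χ sin(2kθ·y)`. The correlation at frequencies
`k` and `k + τ` is therefore a combination of four products of real Gaussian variables, and the
theorem says that the averages of these products follow their expectations: an ergodic theorem for a
Gaussian process that is nearly stationary after multiplication by `k^(m/2)`.

Second moments come from the symbol. Splitting real waves into exponentials reduces a covariance to
pairings of `Op(a)` with two modulated cutoffs (`covariance_waveTest`). Such a pairing is bounded by
the size of the symbol at the first frequency `ζ` times an inverse power of the sum `v` of the two
frequencies (`exists_norm_wavePairing_le`). After normalization, correlations are thus bounded by `C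
/ (1 + |k - l|)`. If `v` stays fixed while `ζ` grows, only the principal symbol survives, and
Fourier inversion produces the Fourier integral of `χ² μ = μ` (`tendsto_wavePairing`). The smooth
mean contributes a rapidly decaying term.

For the ergodic theorem, the covariance of two squares of Gaussian variables is at most twice the
square of their correlation (`integral_sq_mul_sq_of_hasGaussianLaw`), here `O((1 + |k - l|)⁻²)`. An
average over length `T` then has variance `O(1/T)`, which is summable along `T = (j + 1)²`. Since
the integral of a square is monotone in `T`, convergence along the squares gives convergence for all
`T` (`ae_tendsto_average_sq`). Products follow by polarization (`ae_tendsto_average_mul`). -/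

theorem integral_pow_four_of_hasGaussianLaw {Ω : Type*} [MeasurableSpace Ω] {P : Measure Ω}
    {X : Ω → ℝ} (h : HasGaussianLaw X P) :
    ∫ ω, X ω ^ 4 ∂P = 3 * (∫ ω, X ω ^ 2 ∂P) ^ 2 - 2 * (∫ ω, X ω ∂P) ^ 4 := by
  have := h.isProbabilityMeasure
  have hvar : Var[X; P] = (∫ ω, X ω ^ 2 ∂P) - (∫ ω, X ω ∂P) ^ 2 := by
    simpa using variance_eq_sub h.memLp_two
  set a : ℝ := ∫ ω, X ω ∂P
  set v : ℝ := Var[X; P] with hv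
  have hv0 : 0 ≤ v := variance_nonneg _ _
  have hmgf : mgf X P = fun t => Real.exp (a * t + v * t ^ 2 / 2) := by
    ext t
    rw [mgf_gaussianReal h.map_eq_gaussianReal, Real.coe_toNNReal _ hv0]
  have hset : (0 : ℝ) ∈ interior (integrableExpSet X P) := by
    have huniv : integrableExpSet X P = univ := by
      ext t
      simp only [integrableExpSet, mem_ofPred_eq, mem_univ, iff_true]
      have hi := integrable_exp_mul_gaussianReal (μ := a) (v := v.toNNReal) t
      rw [← h.map_eq_gaussianReal] at hi
      exact (integrable_map_measure (by fun_prop) h.aemeasurable).1 hi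
    simp [huniv]
  have hexp : ∀ t, HasDerivAt (fun t => Real.exp (a * t + v * t ^ 2 / 2))
      ((a + v * t) * Real.exp (a * t + v * t ^ 2 / 2)) t := by
    intro t
    have h1 : HasDerivAt (fun t => a * t + v * t ^ 2 / 2) (a + v * t) t := by
      exact (((hasDerivAt_id t).const_mul a).add
        ((((hasDerivAt_id t).pow 2).const_mul v).div_const 2)).congr_deriv (by simp; ring)
    exact h1.exp.congr_deriv (by ring)
  -- The fourth moment is the fourth derivative at 0 of the moment generating function. Each
  -- derivative keeps the Gaussian exponential and turns the polynomial factor `p` into `p' + p (a +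
  -- v t)`.
  have hstep : ∀ (p p' : ℝ → ℝ), (∀ t, HasDerivAt p (p' t) t) →
      deriv (fun t => p t * Real.exp (a * t + v * t ^ 2 / 2)) =
        fun t => (p' t + p t * (a + v * t)) * Real.exp (a * t + v * t ^ 2 / 2) := by
    intro p p' hp
    ext t
    rw [((hp t).fun_mul (hexp t)).deriv]
    ring
  have hlin : ∀ t, HasDerivAt (fun t => a + v * t) v t := by
    intro t
    simpa using ((hasDerivAt_id t).const_mul v).const_add a
  have h4 := iteratedDeriv_mgf_zero hset 4
  have hd1 : deriv (fun t => Real.exp (a * t + v * t ^ 2 / 2)) =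
      fun t => (a + v * t) * Real.exp (a * t + v * t ^ 2 / 2) := by
    ext t
    exact (hexp t).deriv
  rw [hmgf, iteratedDeriv_succ', iteratedDeriv_succ', iteratedDeriv_succ', iteratedDeriv_succ',
    iteratedDeriv_zero, hd1, hstep _ _ hlin,
    hstep (fun t => v + (a + v * t) * (a + v * t)) (fun t => v * (a + v * t) + (a + v * t) * v)
      (fun t => ((hlin t).fun_mul (hlin t)).const_add v),
    hstep (fun t => v * (a + v * t) + (a + v * t) * v + (v + (a + v * t) * (a + v * t)) * (a + v * t))
      (fun t => v * v + v * v + ((v * (a + v * t) + (a + v * t) * v) * (a + v * t) +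
        (v + (a + v * t) * (a + v * t)) * v))
      (fun t => (((hlin t).const_mul v).fun_add ((hlin t).mul_const v)).fun_add
        ((((hlin t).fun_mul (hlin t)).const_add v).fun_mul (hlin t)))] at h4
  simp only [Pi.pow_apply] at h4
  rw [← h4, show ∫ ω, X ω ^ 2 ∂P = v + a ^ 2 by rw [hvar]; ring]
  simp
  ring

/-- Wick's formula for noncentred variables, by polarization: `12 X²Y² = (X+Y)⁴ + (X-Y)⁴ - 2X⁴ -
2Y⁴`, and each linear combination is Gaussian. The means enter with a negative sign, so they can be
dropped in upper bounds. -/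
theorem integral_sq_mul_sq_of_hasGaussianLaw {Ω : Type*} [MeasurableSpace Ω] {P : Measure Ω}
    {X Y : Ω → ℝ} (h : HasGaussianLaw (fun ω => (X ω, Y ω)) P) :
    ∫ ω, X ω ^ 2 * Y ω ^ 2 ∂P = (∫ ω, X ω ^ 2 ∂P) * (∫ ω, Y ω ^ 2 ∂P) +
      2 * (∫ ω, X ω * Y ω ∂P) ^ 2 - 2 * (∫ ω, X ω ∂P) ^ 2 * (∫ ω, Y ω ∂P) ^ 2 := by
  have hX := h.fst
  have hY := h.snd
  have := hX.isProbabilityMeasure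
  have i4 : ∀ {Z : Ω → ℝ}, HasGaussianLaw Z P → Integrable (fun ω => Z ω ^ 4) P := by
    intro Z hZ
    have := (hZ.memLp (p := 4) (by simp)).integrable_norm_pow (p := 4) (by simp)
    simpa [Even.pow_abs (show Even 4 by decide)] using this
  have iadd := i4 h.fun_add
  have isub := i4 h.fun_sub
  have hXX : Integrable (fun ω => X ω ^ 2) P := hX.memLp_two.integrable_sq
  have hYY : Integrable (fun ω => Y ω ^ 2) P := hY.memLp_two.integrable_sq
  have hXY : Integrable (fun ω => X ω * Y ω) P := hX.memLp_two.integrable_mul hY.memLp_two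
  have e : ∀ ω, X ω ^ 2 * Y ω ^ 2 = (1 / 12) * ((X ω + Y ω) ^ 4 + (X ω - Y ω) ^ 4
      - 2 * X ω ^ 4 - 2 * Y ω ^ 4) := fun ω => by ring
  have e1 : ∫ ω, (X ω + Y ω) ^ 2 ∂P = (∫ ω, X ω ^ 2 ∂P) + 2 * (∫ ω, X ω * Y ω ∂P) +
      ∫ ω, Y ω ^ 2 ∂P := by
    rw [← integral_const_mul, ← integral_add hXX (hXY.const_mul 2),
      ← integral_add (hXX.fun_add (hXY.const_mul 2)) hYY]
    exact integral_congr_ae (ae_of_all _ fun ω => by ring)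
  have e2 : ∫ ω, (X ω - Y ω) ^ 2 ∂P = (∫ ω, X ω ^ 2 ∂P) - 2 * (∫ ω, X ω * Y ω ∂P) +
      ∫ ω, Y ω ^ 2 ∂P := by
    rw [← integral_const_mul, ← integral_sub hXX (hXY.const_mul 2),
      ← integral_add (f := fun ω => X ω ^ 2 - 2 * (X ω * Y ω)) (hXX.sub (hXY.const_mul 2)) hYY]
    exact integral_congr_ae (ae_of_all _ fun ω => by ring)
  simp_rw [e]
  rw [integral_const_mul, integral_sub
      (f := fun ω => (X ω + Y ω) ^ 4 + (X ω - Y ω) ^ 4 - 2 * X ω ^ 4)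
      ((iadd.fun_add isub).sub ((i4 hX).const_mul 2)) ((i4 hY).const_mul 2),
    integral_sub (iadd.fun_add isub) ((i4 hX).const_mul 2),
    integral_add iadd isub, integral_const_mul, integral_const_mul,
    integral_pow_four_of_hasGaussianLaw h.fun_add, integral_pow_four_of_hasGaussianLaw h.fun_sub,
    integral_pow_four_of_hasGaussianLaw hX, integral_pow_four_of_hasGaussianLaw hY, e1, e2,
    integral_add hX.integrable hY.integrable, integral_sub hX.integrable hY.integrable]
  ring

/-! ### Almost sure convergence from summable second moments -/

/-- By Tonelli the sum of the `X j ω ^ 2` has finite expectation, hence is almost surely finite, and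
its terms tend to 0. -/
theorem ae_tendsto_zero_of_summable_integral_sq {Ω : Type*} [MeasurableSpace Ω] {P : Measure Ω}
    {X : ℕ → Ω → ℝ} (hX : ∀ j, MemLp (X j) 2 P) {b : ℕ → ℝ} (hb : Summable b)
    (h : ∀ j, ∫ ω, X j ω ^ 2 ∂P ≤ b j) :
    ∀ᵐ ω ∂P, Tendsto (fun j => X j ω) atTop (𝓝 0) := by
  have hm : ∀ j, AEMeasurable (fun ω => ENNReal.ofReal (X j ω ^ 2)) P := fun j =>
    ((hX j).1.aemeasurable.pow_const 2).ennreal_ofReal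
  have hb0 : ∀ j, 0 ≤ b j := fun j => (integral_nonneg fun ω => sq_nonneg _).trans (h j)
  have hsum : ∫⁻ ω, ∑' j, ENNReal.ofReal (X j ω ^ 2) ∂P ≠ ⊤ := by
    rw [lintegral_tsum hm]
    refine ne_top_of_le_ne_top hb.tsum_ofReal_ne_top (ENNReal.tsum_le_tsum fun j => ?_)
    rw [← ofReal_integral_eq_lintegral_ofReal (hX j).integrable_sq
      (ae_of_all _ fun ω => sq_nonneg _)]
    exact ENNReal.ofReal_le_ofReal (h j)
  have hae := ae_lt_top' (AEMeasurable.tsum hm) hsum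
  filter_upwards [hae] with ω hω
  have h0 := ENNReal.tendsto_atTop_zero_of_tsum_ne_top hω.ne
  have h1 := (ENNReal.tendsto_toReal ENNReal.zero_ne_top).comp h0
  have h2 : Tendsto (fun j => X j ω ^ 2) atTop (𝓝 0) := by
    simpa [Function.comp_def, ENNReal.toReal_ofReal (sq_nonneg _)] using h1
  have h3 := h2.sqrt
  simp only [Real.sqrt_sq_eq_abs, Real.sqrt_zero] at h3
  exact (tendsto_zero_iff_abs_tendsto_zero _).2 h3

/-- The second moment of an integral of random variables, through their correlations. -/
theorem integral_sq_integral_le {Ω T : Type*} [MeasurableSpace Ω] [MeasurableSpace T]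
    {P : Measure Ω} [IsProbabilityMeasure P] {ν : Measure T} [IsFiniteMeasure ν]
    {W : Ω × T → ℝ} (hW : StronglyMeasurable W) {B : ℝ}
    (hsq : ∀ᵐ t ∂ν, MemLp (fun ω => W (ω, t)) 2 P ∧ ∫ ω, W (ω, t) ^ 2 ∂P ≤ B)
    {κ : T × T → ℝ} (hκ : Integrable κ (ν.prod ν))
    (hcov : ∀ᵐ z ∂(ν.prod ν), ∫ ω, W (ω, z.1) * W (ω, z.2) ∂P ≤ κ z) :
    MemLp (fun ω => ∫ t, W (ω, t) ∂ν) 2 P ∧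
      ∫ ω, (∫ t, W (ω, t) ∂ν) ^ 2 ∂P ≤ ∫ z, κ z ∂(ν.prod ν) := by
  have hsq1 : ∀ᵐ z ∂(ν.prod ν), MemLp (fun ω => W (ω, z.1)) 2 P ∧
      ∫ ω, W (ω, z.1) ^ 2 ∂P ≤ B := Measure.quasiMeasurePreserving_fst.ae hsq
  have hsq2 : ∀ᵐ z ∂(ν.prod ν), MemLp (fun ω => W (ω, z.2)) 2 P ∧
      ∫ ω, W (ω, z.2) ^ 2 ∂P ≤ B := Measure.quasiMeasurePreserving_snd.ae hsq
  have hm : StronglyMeasurable (fun y : Ω × (T × T) => W (y.1, y.2.1) * W (y.1, y.2.2)) :=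
    (hW.comp_measurable (by fun_prop)).mul (hW.comp_measurable (by fun_prop))
  -- The uniform second moment bound `B` serves only to justify Fubini on the triple product,
  -- through `2|xy| ≤ x² + y²`.
  have hint : Integrable (fun y : Ω × (T × T) => W (y.1, y.2.1) * W (y.1, y.2.2))
      (P.prod (ν.prod ν)) := by
    rw [integrable_prod_iff' hm.aestronglyMeasurable]
    constructor
    · filter_upwards [hsq1, hsq2] with z h1 h2
      exact h1.1.integrable_mul h2.1
    · refine Integrable.of_bound (C := B) ?_ ?_
      · exact (hm.norm.integral_prod_left' (μ := P)).aestronglyMeasurable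
      · filter_upwards [hsq1, hsq2] with z h1 h2
        rw [Real.norm_of_nonneg (integral_nonneg fun _ => norm_nonneg _)]
        have i1 := h1.1.integrable_sq
        have i2 := h2.1.integrable_sq
        calc ∫ ω, ‖W (ω, z.1) * W (ω, z.2)‖ ∂P
            ≤ ∫ ω, (1 / 2) * (W (ω, z.1) ^ 2 + W (ω, z.2) ^ 2) ∂P := by
              refine integral_mono (h1.1.integrable_mul h2.1).norm
                ((i1.add i2).const_mul (1 / 2)) fun ω => ?_
              simp only [norm_mul, Real.norm_eq_abs]
              nlinarith [sq_nonneg (|W (ω, z.1)| - |W (ω, z.2)|), sq_abs (W (ω, z.1)),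
                sq_abs (W (ω, z.2))]
          _ = (1 / 2) * (∫ ω, W (ω, z.1) ^ 2 ∂P + ∫ ω, W (ω, z.2) ^ 2 ∂P) := by
              rw [integral_const_mul, integral_add i1 i2]
          _ ≤ B := by linarith [h1.2, h2.2]
  have hF : StronglyMeasurable (fun ω => ∫ t, W (ω, t) ∂ν) := hW.integral_prod_right'
  have heq : ∀ ω, (∫ t, W (ω, t) ∂ν) ^ 2 = ∫ z, W (ω, z.1) * W (ω, z.2) ∂(ν.prod ν) := by
    intro ω
    rw [integral_prod_mul (fun t => W (ω, t)) (fun t => W (ω, t)), sq]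
  constructor
  · rw [memLp_two_iff_integrable_sq hF.aestronglyMeasurable]
    simp_rw [heq]
    exact hint.integral_prod_left
  · simp_rw [heq]
    rw [integral_integral_swap (f := fun ω (z : T × T) => W (ω, z.1) * W (ω, z.2)) hint]
    exact integral_mono_ae hint.integral_prod_right hκ hcov

/-! ### Long-time averages and the law of large numbers for squares -/

/-- Averages of a function with a limit at infinity. -/
theorem tendsto_inv_mul_integral_of_tendsto {g : ℝ → ℝ} {l : ℝ}
    (hg : ∀ T, 1 ≤ T → IntervalIntegrable g volume 1 T) (hl : Tendsto g atTop (𝓝 l)) :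
    Tendsto (fun T : ℝ => T⁻¹ * ∫ k in (1 : ℝ)..T, g k) atTop (𝓝 l) := by
  rw [Metric.tendsto_atTop]
  intro ε hε
  obtain ⟨A₀, hA₀⟩ := (Metric.tendsto_atTop.1 hl) (ε / 2) (half_pos hε)
  set A := max A₀ 1
  have hA1 : 1 ≤ A := le_max_right _ _
  set M := |∫ k in (1 : ℝ)..A, (g k - l)| + |l|
  have hM : 0 ≤ M := by positivity
  -- Beyond `A` the integrand is within `ε / 2` of its limit. The remaining contribution is at most
  -- `M`, and `T > 2M/ε` makes `M / T` less than `ε / 2`.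
  refine ⟨max A (2 * M / ε + 1), fun T hT => ?_⟩
  have hTA : A ≤ T := (le_max_left _ _).trans hT
  have hTM : 2 * M / ε + 1 ≤ T := (le_max_right _ _).trans hT
  have hT0 : 0 < T := by linarith
  have hgl : ∀ T, 1 ≤ T → IntervalIntegrable (fun k => g k - l) volume 1 T := fun T hT =>
    (hg T hT).sub intervalIntegrable_const
  have hAT : IntervalIntegrable (fun k => g k - l) volume A T :=
    (hgl A hA1).symm.trans (hgl T (hA1.trans hTA))
  have e : T⁻¹ * (∫ k in (1 : ℝ)..T, g k) - l =
      T⁻¹ * ((∫ k in (1 : ℝ)..A, (g k - l)) + (∫ k in A..T, (g k - l)) - l) := by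
    rw [intervalIntegral.integral_add_adjacent_intervals (hgl A hA1) hAT,
      intervalIntegral.integral_sub (hg T (hA1.trans hTA)) intervalIntegrable_const,
      intervalIntegral.integral_const, smul_eq_mul]
    field_simp
    ring
  have h2 : |∫ k in A..T, (g k - l)| ≤ ε / 2 * (T - A) := by
    have := intervalIntegral.norm_integral_le_of_norm_le_const (a := A) (b := T) (C := ε / 2)
      (f := fun k => g k - l) fun k hk => by
        rw [uIoc_of_le hTA] at hk
        have := hA₀ k ((le_max_left _ _).trans hk.1.le)
        rw [Real.dist_eq] at this
        exact this.le
    rwa [abs_of_nonneg (by linarith : 0 ≤ T - A)] at this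
  rw [Real.dist_eq, e, abs_mul, abs_of_pos (inv_pos.2 hT0), inv_mul_lt_iff₀ hT0]
  have h3 : |(∫ k in (1 : ℝ)..A, (g k - l)) + (∫ k in A..T, (g k - l)) - l| ≤
      M + ε / 2 * (T - A) := by
    refine (abs_sub _ _).trans ?_
    have := abs_add_le (∫ k in (1 : ℝ)..A, (g k - l)) (∫ k in A..T, (g k - l))
    simp only [M]
    linarith
  have h4 : 2 * M / ε < T := by linarith
  rw [div_lt_iff₀ hε] at h4
  nlinarith

/-- The kernel depends only on the difference and has total mass `π` on the line, so its integral
over a square of side `T` grows linearly rather than quadratically. -/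
theorem integral_inv_one_add_sub_sq_le {T : ℝ} (hT : 1 ≤ T) :
    ∫ z, (1 + (z.1 - z.2) ^ 2)⁻¹
      ∂((volume.restrict (Ioc 1 T)).prod (volume.restrict (Ioc (1 : ℝ) T))) ≤ Real.pi * T := by
  have hc : Continuous fun z : ℝ × ℝ => (1 + (z.1 - z.2) ^ 2)⁻¹ := by
    refine Continuous.inv₀ (by fun_prop) fun z => by positivity
  have hi : Integrable (fun z : ℝ × ℝ => (1 + (z.1 - z.2) ^ 2)⁻¹)
      ((volume.restrict (Ioc 1 T)).prod (volume.restrict (Ioc (1 : ℝ) T))) := by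
    refine Integrable.of_bound (C := 1) hc.aestronglyMeasurable (ae_of_all _ fun z => ?_)
    rw [Real.norm_of_nonneg (by positivity)]
    exact inv_le_one_of_one_le₀ (by nlinarith [sq_nonneg (z.1 - z.2)])
  rw [integral_prod _ hi]
  have h1 : ∀ x : ℝ, ∫ y in Ioc 1 T, (1 + (x - y) ^ 2)⁻¹ ≤ Real.pi := by
    intro x
    have hx : Integrable (fun y : ℝ => (1 + (x - y) ^ 2)⁻¹) :=
      integrable_inv_one_add_sq.comp_sub_left x
    calc ∫ y in Ioc 1 T, (1 + (x - y) ^ 2)⁻¹ ≤ ∫ y, (1 + (x - y) ^ 2)⁻¹ :=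
          setIntegral_le_integral hx (ae_of_all _ fun y => by positivity)
      _ = Real.pi := by
          rw [integral_sub_left_eq_self (fun y : ℝ => (1 + y ^ 2)⁻¹) volume x,
            integral_univ_inv_one_add_sq]
  calc ∫ x in Ioc 1 T, ∫ y in Ioc 1 T, (1 + (x - y) ^ 2)⁻¹
      ≤ ∫ _x in Ioc 1 T, Real.pi := by
        refine integral_mono hi.integral_prod_left (integrable_const _) fun x => h1 x
    _ ≤ Real.pi * T := by
        rw [setIntegral_const, smul_eq_mul, measureReal_def, Real.volume_Ioc,
          ENNReal.toReal_ofReal (by linarith), mul_comm]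
        exact mul_le_mul_of_nonneg_left (by linarith) Real.pi_pos.le

/-- A monotone function whose ratio to the identity converges along the squares. -/
theorem tendsto_div_of_monotone_of_tendsto_sq {F : ℝ → ℝ} {l : ℝ} (hF : Monotone F)
    (h : Tendsto (fun j : ℕ => F (((j : ℝ) + 1) ^ 2) / ((j : ℝ) + 1) ^ 2) atTop (𝓝 l)) :
    Tendsto (fun T => F T / T) atTop (𝓝 l) := by
  have hnat : Tendsto (fun n : ℕ => F n / n) atTop (𝓝 l) := by
    -- Consecutive squares have ratio tending to 1, so for any `a > 1` they eventually grow by a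
    -- factor at most `a`. This is what lets monotonicity fill the gaps.
    refine tendsto_div_of_monotone_of_exists_subseq_tendsto_div (fun n : ℕ => F n) l
      (fun a b hab => hF (by exact_mod_cast hab)) fun a ha => ⟨fun n => (n + 1) ^ 2, ?_, ?_, ?_⟩
    · have h1 : Tendsto (fun n : ℕ => (1 + 1 / ((n : ℝ) + 1)) ^ 2) atTop (𝓝 ((1 + 0) ^ 2)) :=
        (tendsto_one_div_add_atTop_nhds_zero_nat.const_add 1).pow 2
      filter_upwards [h1.eventually (gt_mem_nhds (by simpa using ha))] with n hn
      push_cast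
      have e : ((n : ℝ) + 1 + 1) ^ 2 = (1 + 1 / ((n : ℝ) + 1)) ^ 2 * ((n : ℝ) + 1) ^ 2 := by
        field_simp
      rw [e]
      exact mul_le_mul_of_nonneg_right hn.le (by positivity)
    · exact tendsto_atTop_mono (fun n => by simp only [id]; nlinarith) tendsto_id
    · simpa using h
  -- Real arguments are squeezed between their integer floor and ceiling, again by monotonicity.
  have hfl : Tendsto (fun T : ℝ => F ⌊T⌋₊ / ⌊T⌋₊ * (⌊T⌋₊ / T)) atTop (𝓝 (l * 1)) :=
    (hnat.comp tendsto_nat_floor_atTop).mul (tendsto_nat_floor_div_atTop (R := ℝ))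
  have hce : Tendsto (fun T : ℝ => F ⌈T⌉₊ / ⌈T⌉₊ * (⌈T⌉₊ / T)) atTop (𝓝 (l * 1)) :=
    (hnat.comp tendsto_nat_ceil_atTop).mul (tendsto_nat_ceil_div_atTop (R := ℝ))
  rw [mul_one] at hfl hce
  refine tendsto_of_tendsto_of_tendsto_of_le_of_le' hfl hce ?_ ?_
  · filter_upwards [eventually_ge_atTop 1] with T hT
    have : (0 : ℝ) < ⌊T⌋₊ := by exact_mod_cast Nat.floor_pos.2 hT
    rw [div_mul_div_cancel₀ this.ne']
    exact div_le_div_of_nonneg_right (hF (Nat.floor_le (by linarith))) (by linarith)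
  · filter_upwards [eventually_ge_atTop 1] with T hT
    have : (0 : ℝ) < ⌈T⌉₊ := by exact_mod_cast Nat.ceil_pos.2 (by linarith)
    rw [div_mul_div_cancel₀ this.ne']
    exact div_le_div_of_nonneg_right (hF (Nat.le_ceil _)) (by linarith)

/-- A law of large numbers for the squares of a Gaussian process with decaying correlations,
whose paths are continuous. -/
theorem ae_tendsto_average_sq_of_continuous {Ω : Type*} [MeasurableSpace Ω] {P : Measure Ω}
    [IsProbabilityMeasure P] {V : ℝ → Ω → ℝ} (hG : IsGaussianProcess V P)
    (hm : ∀ k, Measurable (V k)) (hc : ∀ ω, Continuous fun k => V k ω) {C L : ℝ}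
    (hC : ∀ k, 1 ≤ k → ∀ l, 1 ≤ l → |∫ ω, V k ω * V l ω ∂P| ≤ C / (1 + |k - l|))
    (hL : Tendsto (fun k => ∫ ω, V k ω ^ 2 ∂P) atTop (𝓝 L)) :
    ∀ᵐ ω ∂P, Tendsto (fun K : ℝ => K⁻¹ * ∫ k in K..(2 * K), V k ω ^ 2) atTop (𝓝 L) := by
  set g : ℝ → ℝ := fun k => ∫ ω, V k ω ^ 2 ∂P
  have hVsm : StronglyMeasurable (fun y : Ω × ℝ => V y.2 y.1) :=
    (stronglyMeasurable_uncurry_of_continuous_of_stronglyMeasurable (u := V) hc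
      fun k => (hm k).stronglyMeasurable).comp_measurable measurable_swap
  have hV2sm : StronglyMeasurable (fun y : Ω × ℝ => V y.2 y.1 ^ 2) := hVsm.pow 2
  have hgsm : StronglyMeasurable g := hV2sm.integral_prod_left' (μ := P)
  have hg0 : ∀ k, 0 ≤ g k := fun k => integral_nonneg fun ω => sq_nonneg _
  have hgC : ∀ k, 1 ≤ k → g k ≤ C := by
    intro k hk
    have := (le_abs_self _).trans (hC k hk k hk)
    simpa [g, sq] using this
  have hC0 : 0 ≤ C := (hg0 1).trans (hgC 1 le_rfl)
  have hgint : ∀ T, 1 ≤ T → IntegrableOn g (Ioc 1 T) := fun T hT => by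
    refine Integrable.of_bound (C := C) hgsm.aestronglyMeasurable ?_
    filter_upwards [ae_restrict_mem measurableSet_Ioc] with k hk
    rw [Real.norm_of_nonneg (hg0 k)]
    exact hgC k hk.1.le
  have hgav := tendsto_inv_mul_integral_of_tendsto
    (fun T hT => (intervalIntegrable_iff_integrableOn_Ioc_of_le hT).2 (hgint T hT)) hL
  have h4 : ∀ k, MemLp (fun ω => V k ω ^ 2) 2 P := fun k => by
    have h := ((hG.hasGaussianLaw_eval k).memLp (p := 4) (by simp))
    rw [memLp_two_iff_integrable_sq ((hm k).pow_const 2).aestronglyMeasurable]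
    have := h.integrable_norm_pow (p := 4) (by simp)
    refine this.congr (ae_of_all _ fun ω => ?_)
    simp only [Real.norm_eq_abs, Even.pow_abs (show Even 4 by decide)]
    ring
  set W : Ω × ℝ → ℝ := fun y => V y.2 y.1 ^ 2 - g y.2
  have hWsm : StronglyMeasurable W := hV2sm.sub (hgsm.comp_measurable measurable_snd)
  have hWmem : ∀ k, MemLp (fun ω => W (ω, k)) 2 P := fun k => (h4 k).sub (memLp_const (g k))
  have hWcov : ∀ k, 1 ≤ k → ∀ l, 1 ≤ l → ∫ ω, W (ω, k) * W (ω, l) ∂P ≤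
      2 * C ^ 2 * (1 + (k - l) ^ 2)⁻¹ := by
    intro k hk l hl
    have i1 : Integrable (fun ω => V k ω ^ 2 * V l ω ^ 2) P := (h4 k).integrable_mul (h4 l)
    have i2 : Integrable (fun ω => V k ω ^ 2) P := (h4 k).integrable (by norm_num)
    have i3 : Integrable (fun ω => V l ω ^ 2) P := (h4 l).integrable (by norm_num)
    have e : ∫ ω, W (ω, k) * W (ω, l) ∂P =
        (∫ ω, V k ω ^ 2 * V l ω ^ 2 ∂P) - g k * g l := by
      have : ∀ ω, W (ω, k) * W (ω, l) =
          V k ω ^ 2 * V l ω ^ 2 - g l * V k ω ^ 2 - g k * V l ω ^ 2 + g k * g l := fun ω => by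
        simp only [W]; ring
      simp_rw [this]
      rw [integral_add (f := fun ω => V k ω ^ 2 * V l ω ^ 2 - g l * V k ω ^ 2 - g k * V l ω ^ 2)
          ((i1.sub (i2.const_mul _)).sub (i3.const_mul _)) (integrable_const _),
        integral_sub (f := fun ω => V k ω ^ 2 * V l ω ^ 2 - g l * V k ω ^ 2)
          (i1.sub (i2.const_mul _)) (i3.const_mul _),
        integral_sub i1 (i2.const_mul _), integral_const_mul, integral_const_mul, integral_const]
      simp only [probReal_univ, smul_eq_mul, one_mul]
      change _ - g l * g k - g k * g l + _ = _
      ring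
    -- The covariance of the squares is twice the squared correlation minus a nonnegative term in
    -- the means. Squaring the decay `1/(1 + |k - l|)` is what makes it integrable in `k - l`.
    rw [e, integral_sq_mul_sq_of_hasGaussianLaw (hG.hasGaussianLaw_prodMk (s := k) (t := l))]
    have h1 := hC k hk l hl
    have h2 : (∫ ω, V k ω * V l ω ∂P) ^ 2 ≤ (C / (1 + |k - l|)) ^ 2 :=
      sq_le_sq' (neg_le_of_abs_le h1) (le_of_abs_le h1)
    have h3 : (C / (1 + |k - l|)) ^ 2 ≤ C ^ 2 * (1 + (k - l) ^ 2)⁻¹ := by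
      rw [div_pow, div_eq_mul_inv]
      refine mul_le_mul_of_nonneg_left (inv_anti₀ (by positivity) ?_) (sq_nonneg _)
      nlinarith [abs_nonneg (k - l), sq_abs (k - l)]
    have h5 : 0 ≤ 2 * (∫ ω, V k ω ∂P) ^ 2 * (∫ ω, V l ω ∂P) ^ 2 := by positivity
    change g k * g l + _ - _ - g k * g l ≤ _
    linarith
  have hvar : ∀ T, 1 ≤ T → MemLp (fun ω => ∫ k in Ioc 1 T, W (ω, k)) 2 P ∧
      ∫ ω, (∫ k in Ioc 1 T, W (ω, k)) ^ 2 ∂P ≤ 2 * C ^ 2 * (Real.pi * T) := by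
    intro T hT
    have hcκ : Continuous fun z : ℝ × ℝ => 2 * C ^ 2 * (1 + (z.1 - z.2) ^ 2)⁻¹ :=
      continuous_const.mul (Continuous.inv₀ (by fun_prop) fun z => by positivity)
    have hae : ∀ᵐ k ∂(volume.restrict (Ioc (1 : ℝ) T)), k ∈ Ioc 1 T :=
      ae_restrict_mem measurableSet_Ioc
    have := integral_sq_integral_le (P := P) (ν := volume.restrict (Ioc (1 : ℝ) T)) hWsm
      (B := 2 * C ^ 2) ?_ (κ := fun z => 2 * C ^ 2 * (1 + (z.1 - z.2) ^ 2)⁻¹) ?_ ?_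
    · refine ⟨this.1, this.2.trans ?_⟩
      rw [integral_const_mul]
      exact mul_le_mul_of_nonneg_left (integral_inv_one_add_sub_sq_le hT) (by positivity)
    · filter_upwards [hae] with k hk
      refine ⟨hWmem k, ?_⟩
      have := hWcov k hk.1.le k hk.1.le
      simpa [sq] using this
    · refine Integrable.of_bound (C := 2 * C ^ 2) hcκ.aestronglyMeasurable
        (ae_of_all _ fun z => ?_)
      rw [Real.norm_of_nonneg (by positivity)]
      exact mul_le_of_le_one_right (by positivity)
        (inv_le_one_of_one_le₀ (by nlinarith [sq_nonneg (z.1 - z.2)]))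
    · filter_upwards [Measure.quasiMeasurePreserving_fst.ae hae,
        Measure.quasiMeasurePreserving_snd.ae hae] with z h1 h2
      exact hWcov _ h1.1.le _ h2.1.le
  have hone : ∀ j : ℕ, (1 : ℝ) ≤ ((j : ℝ) + 1) ^ 2 := fun j => by
    nlinarith [(Nat.cast_nonneg j : (0 : ℝ) ≤ j)]
  -- The variance of the average over length `T` is `O(1/T)`; sampling at `T = (j + 1)²` makes it
  -- summable.
  have hconv := ae_tendsto_zero_of_summable_integral_sq (P := P)
    (X := fun j ω => (((j : ℝ) + 1) ^ 2)⁻¹ * ∫ k in Ioc 1 (((j : ℝ) + 1) ^ 2), W (ω, k))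
    (fun j => (hvar _ (hone j)).1.const_mul _)
    (b := fun j => 2 * C ^ 2 * Real.pi * (((j : ℝ) + 1) ^ 2)⁻¹) ?_ ?_
  · filter_upwards [hconv] with ω hω
    have hi : ∀ a b, IntervalIntegrable (fun k => V k ω ^ 2) volume a b := fun a b =>
      ((hc ω).pow 2).intervalIntegrable a b
    have hF : Monotone fun T : ℝ => ∫ k in (1 : ℝ)..T, V k ω ^ 2 := by
      intro a b hab
      have := intervalIntegral.integral_add_adjacent_intervals (hi 1 a) (hi a b)
      have h0 : 0 ≤ ∫ k in a..b, V k ω ^ 2 :=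
        intervalIntegral.integral_nonneg hab fun k _ => sq_nonneg _
      simp only
      linarith
    have hsq : Tendsto (fun j : ℕ => ((j : ℝ) + 1) ^ 2) atTop atTop :=
      tendsto_atTop_mono (fun j => by nlinarith [(Nat.cast_nonneg j : (0 : ℝ) ≤ j)])
        tendsto_natCast_atTop_atTop
    have hlim := tendsto_div_of_monotone_of_tendsto_sq (l := L) hF (by
      have := hω.add (hgav.comp hsq)
      rw [zero_add] at this
      refine this.congr fun j => ?_
      have e : ∫ k in Ioc 1 (((j : ℝ) + 1) ^ 2), W (ω, k) =
          (∫ k in (1 : ℝ)..((j : ℝ) + 1) ^ 2, V k ω ^ 2) -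
            ∫ k in (1 : ℝ)..((j : ℝ) + 1) ^ 2, g k := by
        rw [← intervalIntegral.integral_sub (hi _ _)
          ((intervalIntegrable_iff_integrableOn_Ioc_of_le (hone j)).2 (hgint _ (hone j))),
          intervalIntegral.integral_of_le (hone j)]
      simp only [Function.comp_apply]
      rw [e]
      ring)
    have h2 : Tendsto (fun K : ℝ => 2 * K) atTop atTop :=
      tendsto_id.const_mul_atTop (by norm_num)
    -- The average over `[K, 2K]` is twice the average up to `2K` minus the average up to `K`,
    -- giving `2L - L`.
    have := ((hlim.comp h2).const_mul 2).sub hlim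
    rw [show 2 * L - L = L by ring] at this
    refine this.congr fun K => ?_
    simp only [Function.comp_apply]
    rw [← intervalIntegral.integral_interval_sub_left (hi 1 (2 * K)) (hi 1 K), mul_sub,
      ← mul_div_assoc, mul_div_mul_left _ _ two_ne_zero, div_eq_inv_mul, div_eq_inv_mul]
  · have := (summable_nat_add_iff (f := fun j : ℕ => ((j : ℝ) ^ 2)⁻¹) 1).2
      (Real.summable_nat_pow_inv.2 one_lt_two)
    simpa using this.mul_left (2 * C ^ 2 * Real.pi)
  · intro j
    simp only [mul_pow]
    rw [integral_const_mul]
    have hj : (0 : ℝ) < ((j : ℝ) + 1) ^ 2 := by positivity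
    calc ((((j : ℝ) + 1) ^ 2)⁻¹) ^ 2 * ∫ ω, (∫ k in Ioc 1 (((j : ℝ) + 1) ^ 2), W (ω, k)) ^ 2 ∂P
        ≤ ((((j : ℝ) + 1) ^ 2)⁻¹) ^ 2 * (2 * C ^ 2 * (Real.pi * ((j : ℝ) + 1) ^ 2)) :=
          mul_le_mul_of_nonneg_left (hvar _ (hone j)).2 (by positivity)
      _ = 2 * C ^ 2 * Real.pi * (((j : ℝ) + 1) ^ 2)⁻¹ := by field_simp

/-- A law of large numbers for the squares of a Gaussian process with decaying correlations,
whose paths are almost surely continuous. -/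
theorem ae_tendsto_average_sq {Ω : Type*} [MeasurableSpace Ω] {P : Measure Ω}
    [IsProbabilityMeasure P] {V : ℝ → Ω → ℝ} (hG : IsGaussianProcess V P)
    (hm : ∀ k, Measurable (V k)) (hc : ∀ᵐ ω ∂P, Continuous fun k => V k ω) {C L : ℝ}
    (hC : ∀ k, 1 ≤ k → ∀ l, 1 ≤ l → |∫ ω, V k ω * V l ω ∂P| ≤ C / (1 + |k - l|))
    (hL : Tendsto (fun k => ∫ ω, V k ω ^ 2 ∂P) atTop (𝓝 L)) :
    ∀ᵐ ω ∂P, Tendsto (fun K : ℝ => K⁻¹ * ∫ k in K..(2 * K), V k ω ^ 2) atTop (𝓝 L) := by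
  -- The set of discontinuous paths need not be measurable. The process is set to zero on a
  -- measurable null set containing it, which changes neither the Gaussian laws nor the moments.
  set s := toMeasurable P {ω | ¬ Continuous fun k => V k ω}
  have hs : ∀ᵐ ω ∂P, ω ∈ sᶜ := by
    rw [ae_iff]
    simp only [mem_compl_iff, not_not]
    exact (measure_toMeasurable _).trans hc
  have hsm : MeasurableSet sᶜ := (measurableSet_toMeasurable _ _).compl
  have heq : ∀ᵐ ω ∂P, ∀ k, sᶜ.indicator (V k) ω = V k ω := by
    filter_upwards [hs] with ω hω k
    exact indicator_of_mem hω _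
  have h := ae_tendsto_average_sq_of_continuous (P := P) (V := fun k => sᶜ.indicator (V k))
    (C := C) (L := L) (hG.congr fun k => heq.mono fun ω hω => (hω k).symm)
    (fun k => (hm k).indicator hsm) ?_ ?_ ?_
  · filter_upwards [h, heq] with ω hω h2
    simpa only [h2] using hω
  · intro ω
    by_cases hω : ω ∈ sᶜ
    · simp only [indicator_of_mem hω]
      by_contra hcon
      exact hω (subset_toMeasurable _ _ hcon)
    · simp only [indicator_of_notMem hω]
      exact continuous_const
  · intro k hk l hl
    rw [integral_congr_ae (g := fun ω => V k ω * V l ω)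
      (heq.mono fun ω hω => by simp only [hω])]
    exact hC k hk l hl
  · refine hL.congr fun k => integral_congr_ae (heq.mono fun ω hω => by simp only [hω])

/-! ### The Fourier transform with the kernel `e^{-i y·ξ}` -/

/-- `∫ e^{-i y·ξ} f(y) dy`. -/
noncomputable def fourierInt {n : ℕ} (f : Rn n → ℂ) (ξ : Rn n) : ℂ :=
  ∫ y : Rn n, Complex.exp (-(Complex.I * ((inner ℝ y ξ : ℝ) : ℂ))) * f y

open scoped FourierTransform in
theorem fourierInt_eq_fourier {n : ℕ} (f : Rn n → ℂ) (ξ : Rn n) :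
    fourierInt f ξ = 𝓕 f ((2 * Real.pi)⁻¹ • ξ) := by
  rw [Real.fourier_eq', fourierInt]
  congr 1
  ext y
  rw [smul_eq_mul, inner_smul_right]
  congr 2
  have := Real.pi_pos.ne'
  push_cast
  field_simp

theorem norm_exp_I_mul_ofReal (t : ℝ) : ‖Complex.exp (Complex.I * (t : ℂ))‖ = 1 := by
  rw [mul_comm]
  exact Complex.norm_exp_ofReal_mul_I t

theorem norm_exp_neg_I_mul_ofReal (t : ℝ) : ‖Complex.exp (-(Complex.I * (t : ℂ)))‖ = 1 := by
  have := norm_exp_I_mul_ofReal (-t)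
  rwa [Complex.ofReal_neg, mul_neg] at this

theorem norm_fourierInt_le {n : ℕ} (f : Rn n → ℂ) (ξ : Rn n) :
    ‖fourierInt f ξ‖ ≤ ∫ y, ‖f y‖ := by
  refine (norm_integral_le_integral_norm _).trans_eq ?_
  simp only [norm_mul, norm_exp_neg_I_mul_ofReal, one_mul]

open scoped FourierTransform in
/-- One integration by parts. -/
theorem one_add_norm_mul_norm_fourierInt_le {n : ℕ} {f : Rn n → ℂ} (hf : ContDiff ℝ 1 f)
    (hc : HasCompactSupport f) (ξ : Rn n) :
    (1 + ‖ξ‖) * ‖fourierInt f ξ‖ ≤ (∫ y, ‖f y‖) + ∫ y, ‖fderiv ℝ f y‖ := by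
  have hi : Integrable f := hf.continuous.integrable_of_hasCompactSupport hc
  have hi' : Integrable (fderiv ℝ f) :=
    (hf.continuous_fderiv one_ne_zero).integrable_of_hasCompactSupport (hc.fderiv ℝ)
  have h1 := congrFun (Real.fourier_fderiv hi (hf.differentiable one_ne_zero) hi')
    ((2 * Real.pi)⁻¹ • ξ)
  have h2 : ‖𝓕 (fderiv ℝ f) ((2 * Real.pi)⁻¹ • ξ)‖ ≤ ∫ y, ‖fderiv ℝ f y‖ := by
    rw [Real.fourier_eq]
    refine (norm_integral_le_integral_norm _).trans_eq ?_
    simp only [Circle.norm_smul]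
  rw [h1] at h2
  have h3 : ‖ξ‖ * ‖fourierInt f ξ‖ ≤ ∫ y, ‖fderiv ℝ f y‖ := by
    rcases eq_or_ne ξ 0 with rfl | hξ
    · rw [norm_zero, zero_mul]
      exact integral_nonneg fun _ => norm_nonneg _
    -- The transform of the derivative is evaluated on the vector `ξ` itself: this gives `‖ξ‖²` on
    -- the left and `‖ξ‖` on the right, and one factor cancels.
    have h4 := (VectorFourier.fourierSMulRight (-innerSL ℝ) (𝓕 f)
      ((2 * Real.pi)⁻¹ • ξ)).le_opNorm ξ
    rw [VectorFourier.fourierSMulRight_apply, ← fourierInt_eq_fourier] at h4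
    have hpos : 0 < ‖ξ‖ := norm_pos_iff.2 hξ
    have e : ‖-(2 * (Real.pi : ℂ) * Complex.I) •
        ((-innerSL ℝ) ((2 * Real.pi)⁻¹ • ξ) ξ) • fourierInt f ξ‖ =
        ‖ξ‖ * ‖ξ‖ * ‖fourierInt f ξ‖ := by
      simp only [norm_smul, norm_neg, norm_mul, Complex.norm_I, Complex.norm_real,
        neg_apply, innerSL_apply_apply, inner_smul_left,
        real_inner_self_eq_norm_mul_norm, Real.norm_eq_abs, abs_of_pos Real.pi_pos, abs_norm,
        abs_mul, RCLike.norm_ofNat, map_inv₀, abs_inv, conj_trivial, Nat.abs_ofNat]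
      have := Real.pi_pos.ne'
      field_simp
    rw [e] at h4
    have h5 := h4.trans (mul_le_mul_of_nonneg_right h2 hpos.le)
    rw [mul_assoc, mul_comm _ ‖ξ‖] at h5
    exact le_of_mul_le_mul_left (by linarith) hpos
  have := norm_fourierInt_le f ξ
  linarith

open scoped FourierTransform in
theorem exists_fourierInt_eq_schwartz {n : ℕ} {f : Rn n → ℂ} (hf : ContDiff ℝ (⊤ : ℕ∞) f)
    (hc : HasCompactSupport f) :
    ∃ g : SchwartzMap (Rn n) ℂ, ∀ ξ, fourierInt f ξ = g ((2 * Real.pi)⁻¹ • ξ) :=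
  ⟨𝓕 (hc.toSchwartzMap hf), fun ξ => by
    rw [fourierInt_eq_fourier, SchwartzMap.fourier_coe]
    rfl⟩

theorem continuous_fourierInt {n : ℕ} {f : Rn n → ℂ} (hf : ContDiff ℝ (⊤ : ℕ∞) f)
    (hc : HasCompactSupport f) : Continuous (fourierInt f) := by
  obtain ⟨g, hg⟩ := exists_fourierInt_eq_schwartz hf hc
  rw [funext hg]
  exact g.continuous.comp (continuous_const_smul _)

theorem exists_norm_fourierInt_le {n : ℕ} {f : Rn n → ℂ} (hf : ContDiff ℝ (⊤ : ℕ∞) f)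
    (hc : HasCompactSupport f) (p : ℝ) :
    ∃ C : ℝ, 0 ≤ C ∧ ∀ ξ, ‖fourierInt f ξ‖ ≤ C * (1 + ‖ξ‖) ^ (-p) := by
  obtain ⟨g, hg⟩ := exists_fourierInt_eq_schwartz hf hc
  obtain ⟨N, hN⟩ := exists_nat_ge p
  set C := 2 ^ N * ((Finset.Iic (N, 0)).sup fun m => SchwartzMap.seminorm ℝ m.1 m.2) g
  have hC : 0 ≤ C := by positivity
  refine ⟨(2 * Real.pi) ^ N * C, by positivity, fun ξ => ?_⟩
  have h1 := SchwartzMap.one_add_le_sup_seminorm_apply (𝕜 := ℝ) (m := (N, 0)) le_rfl le_rfl g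
    ((2 * Real.pi)⁻¹ • ξ)
  rw [norm_iteratedFDeriv_zero, ← hg] at h1
  have hpi : (1 : ℝ) ≤ 2 * Real.pi := by linarith [Real.pi_gt_three]
  -- The factor `(2π)^N` pays for the rescaling between the kernels `e^{-iy·ξ}` and `e^{-2πiy·ξ}`.
  have h2 : 1 + ‖ξ‖ ≤ 2 * Real.pi * (1 + ‖(2 * Real.pi)⁻¹ • ξ‖) := by
    rw [norm_smul, norm_inv, Real.norm_of_nonneg (by linarith : 0 ≤ 2 * Real.pi), mul_add,
      mul_inv_cancel_left₀ (by linarith), mul_one]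
    linarith
  have h3 : (1 + ‖ξ‖) ^ N * ‖fourierInt f ξ‖ ≤ (2 * Real.pi) ^ N * C := by
    calc (1 + ‖ξ‖) ^ N * ‖fourierInt f ξ‖
        ≤ (2 * Real.pi * (1 + ‖(2 * Real.pi)⁻¹ • ξ‖)) ^ N * ‖fourierInt f ξ‖ := by gcongr
      _ = (2 * Real.pi) ^ N * ((1 + ‖(2 * Real.pi)⁻¹ • ξ‖) ^ N * ‖fourierInt f ξ‖) := by
          rw [mul_pow, mul_assoc]
      _ ≤ _ := mul_le_mul_of_nonneg_left h1 (by positivity)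
  have h0 : 1 ≤ 1 + ‖ξ‖ := by linarith [norm_nonneg ξ]
  rw [Real.rpow_neg (by linarith), ← div_eq_mul_inv, le_div_iff₀ (by positivity : 0 < (1 + ‖ξ‖) ^ p), mul_comm]
  refine le_trans (mul_le_mul_of_nonneg_right ?_ (norm_nonneg _)) h3
  rw [← Real.rpow_natCast]
  exact Real.rpow_le_rpow_of_exponent_le h0 hN

theorem continuous_one_add_norm_rpow {n : ℕ} (p : ℝ) :
    Continuous fun ξ : Rn n => (1 + ‖ξ‖) ^ p :=
  (continuous_const.add continuous_norm).rpow_const fun ξ =>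
    Or.inl (add_pos_of_pos_of_nonneg one_pos (norm_nonneg ξ)).ne'

theorem integrable_rpow_mul_norm_fourierInt {n : ℕ} {f : Rn n → ℂ}
    (hf : ContDiff ℝ (⊤ : ℕ∞) f) (hc : HasCompactSupport f) (p : ℝ) :
    Integrable fun ξ : Rn n => (1 + ‖ξ‖) ^ p * ‖fourierInt f ξ‖ := by
  obtain ⟨C, hC0, hC⟩ := exists_norm_fourierInt_le hf hc (p + (n + 1))
  have hi : Integrable fun ξ : Rn n => C * (1 + ‖ξ‖) ^ (-((n : ℝ) + 1)) :=
    (integrable_one_add_norm (by simp)).const_mul C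
  refine hi.mono' ((continuous_one_add_norm_rpow p).mul
    (continuous_fourierInt hf hc).norm).aestronglyMeasurable (ae_of_all _ fun ξ => ?_)
  have h0 : 0 < 1 + ‖ξ‖ := by positivity
  rw [Real.norm_of_nonneg (by positivity)]
  calc (1 + ‖ξ‖) ^ p * ‖fourierInt f ξ‖
      ≤ (1 + ‖ξ‖) ^ p * (C * (1 + ‖ξ‖) ^ (-(p + (n + 1)))) :=
        mul_le_mul_of_nonneg_left (hC ξ) (by positivity)
    _ = C * (1 + ‖ξ‖) ^ (-((n : ℝ) + 1)) := by
        rw [mul_left_comm, ← Real.rpow_add h0]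
        congr 2
        ring

theorem integrable_fourierInt {n : ℕ} {f : Rn n → ℂ} (hf : ContDiff ℝ (⊤ : ℕ∞) f)
    (hc : HasCompactSupport f) : Integrable (fourierInt f) := by
  refine (integrable_rpow_mul_norm_fourierInt hf hc 0).mono'
    (continuous_fourierInt hf hc).aestronglyMeasurable (ae_of_all _ fun ξ => ?_)
  simp

open scoped FourierTransform in
/-- Fourier inversion. -/
theorem integral_exp_mul_fourierInt {n : ℕ} {f : Rn n → ℂ} (hf : ContDiff ℝ (⊤ : ℕ∞) f)
    (hc : HasCompactSupport f) (x : Rn n) :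
    ∫ ξ : Rn n, Complex.exp (Complex.I * ((inner ℝ x ξ : ℝ) : ℂ)) * fourierInt f ξ =
      (((2 * Real.pi) ^ n : ℝ) : ℂ) * f x := by
  have hi : Integrable f := hf.continuous.integrable_of_hasCompactSupport hc
  have hF : Integrable (𝓕 f) := by
    have h := (integrable_fourierInt hf hc).comp_smul (R := 2 * Real.pi)
      (by positivity)
    refine h.congr (ae_of_all _ fun w => ?_)
    simp only
    rw [fourierInt_eq_fourier, smul_smul, inv_mul_cancel₀ (by positivity), one_smul]
  have h1 := congrFun (hf.continuous.fourierInv_fourier_eq hi hF) x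
  have h2 := Measure.integral_comp_smul (volume : Measure (Rn n))
    (fun w => Complex.exp (2 * Real.pi * Complex.I * ((inner ℝ x w : ℝ) : ℂ)) * 𝓕 f w)
    (2 * Real.pi)⁻¹
  rw [Real.fourierInv_eq'] at h1
  have h3 : ∫ w, Complex.exp (2 * Real.pi * Complex.I * ((inner ℝ x w : ℝ) : ℂ)) * 𝓕 f w =
      f x := by
    rw [← h1]
    congr 1
    ext w
    rw [smul_eq_mul, real_inner_comm]
    congr 2
    push_cast
    ring
  rw [h3] at h2
  simp only [finrank_euclideanSpace, Fintype.card_fin, inv_pow, inv_inv,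
    abs_of_pos (by positivity : (0 : ℝ) < (2 * Real.pi) ^ n), Complex.real_smul] at h2
  rw [← h2]
  congr 1
  ext ξ
  rw [fourierInt_eq_fourier, inner_smul_right]
  congr 2
  have := Real.pi_pos.ne'
  push_cast
  field_simp

/-- The plane wave `e^{i x·ζ}`. -/
noncomputable def expWave {n : ℕ} (ζ x : Rn n) : ℂ :=
  Complex.exp (Complex.I * ((inner ℝ x ζ : ℝ) : ℂ))

theorem norm_expWave {n : ℕ} (ζ x : Rn n) : ‖expWave ζ x‖ = 1 := norm_exp_I_mul_ofReal _

theorem contDiff_expWave_uncurry {n : ℕ} :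
    ContDiff ℝ (⊤ : ℕ∞) fun z : Rn n × Rn n => expWave z.1 z.2 := by
  have h : ContDiff ℝ (⊤ : ℕ∞) (fun z : Rn n × Rn n => ((inner ℝ z.2 z.1 : ℝ) : ℂ)) :=
    Complex.ofRealCLM.contDiff.comp (contDiff_snd.inner ℝ contDiff_fst)
  exact (contDiff_const.mul h).cexp

theorem contDiff_expWave {n : ℕ} (ζ : Rn n) : ContDiff ℝ (⊤ : ℕ∞) (expWave ζ) :=
  contDiff_expWave_uncurry.comp (contDiff_const.prodMk contDiff_id)

theorem Continuous.expWave {X : Type*} [TopologicalSpace X] {n : ℕ} {f g : X → Rn n}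
    (hf : Continuous f) (hg : Continuous g) : Continuous fun x => expWave (f x) (g x) := by
  unfold _root_.expWave
  exact Complex.continuous_exp.comp
    (continuous_const.mul (Complex.continuous_ofReal.comp (hg.inner hf)))

theorem expWave_add {n : ℕ} (ζ ζ' x : Rn n) :
    expWave (ζ + ζ') x = expWave ζ x * expWave ζ' x := by
  rw [expWave, expWave, expWave, ← Complex.exp_add, inner_add_right]
  push_cast
  ring_nf

theorem fourierInt_eq_integral_expWave {n : ℕ} (f : Rn n → ℂ) (ξ : Rn n) :
    fourierInt f ξ = ∫ x, expWave (-ξ) x * f x := by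
  simp only [fourierInt, expWave, inner_neg_right, Complex.ofReal_neg, mul_neg]

theorem fourierInt_expWave_mul {n : ℕ} (f : Rn n → ℂ) (ζ ξ : Rn n) :
    fourierInt (fun x => expWave ζ x * f x) ξ = fourierInt f (ξ - ζ) := by
  rw [fourierInt_eq_integral_expWave, fourierInt_eq_integral_expWave]
  congr 1
  ext x
  rw [neg_sub, sub_eq_add_neg, expWave_add]
  ring

/-! ### Oscillatory integrals with symbols -/

theorem SymbolEstimates.exists_norm_le {n : ℕ} {d : ℝ} {S : Set (Rn n)} {a : Rn n → Rn n → ℂ}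
    (h : SymbolEstimates d S a) :
    ∃ C : ℝ, 0 ≤ C ∧ ∀ x, ∀ ξ ∈ S, ‖a x ξ‖ ≤ C * (1 + ‖ξ‖) ^ d := by
  obtain ⟨C, hC⟩ := h 0 0
  refine ⟨max C 0, le_max_right _ _, fun x ξ hξ => ?_⟩
  have := hC x ξ hξ
  rw [norm_iteratedFDeriv_zero, norm_iteratedFDeriv_zero, Nat.cast_zero, sub_zero] at this
  exact this.trans (mul_le_mul_of_nonneg_right (le_max_left _ _) (by positivity))

theorem SymbolEstimates.exists_norm_fderiv_le {n : ℕ} {d : ℝ} {S : Set (Rn n)}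
    {a : Rn n → Rn n → ℂ} (h : SymbolEstimates d S a) :
    ∃ C : ℝ, 0 ≤ C ∧ ∀ x, ∀ ξ ∈ S,
      ‖fderiv ℝ (fun x' => a x' ξ) x‖ ≤ C * (1 + ‖ξ‖) ^ d := by
  obtain ⟨C, hC⟩ := h 1 0
  refine ⟨max C 0, le_max_right _ _, fun x ξ hξ => ?_⟩
  have := hC x ξ hξ
  have e : (fun x' => iteratedFDeriv ℝ 0 (a x') ξ) =
      (continuousMultilinearCurryFin0 ℝ (Rn n) ℂ).symm ∘ fun x' => a x' ξ := by
    ext x'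
    rfl
  rw [e, LinearIsometryEquiv.norm_iteratedFDeriv_comp_left, norm_iteratedFDeriv_one,
    Nat.cast_zero, sub_zero] at this
  exact this.trans (mul_le_mul_of_nonneg_right (le_max_left _ _) (by positivity))

theorem one_add_norm_le_mul {E : Type*} [SeminormedAddCommGroup E] (η ζ : E) :
    1 + ‖ζ‖ ≤ (1 + ‖η‖) * (1 + ‖η + ζ‖) := by
  have : ‖ζ‖ ≤ ‖η + ζ‖ + ‖η‖ := by
    simpa using norm_sub_le (η + ζ) η
  nlinarith [norm_nonneg η, norm_nonneg (η + ζ)]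

/-- Peetre's inequality. -/
theorem one_add_norm_add_rpow_neg_le {E : Type*} [SeminormedAddCommGroup E] {m : ℝ} (hm : 0 ≤ m)
    (η ζ : E) : (1 + ‖η + ζ‖) ^ (-m) ≤ (1 + ‖η‖) ^ m * (1 + ‖ζ‖) ^ (-m) := by
  have h1 : 0 < 1 + ‖ζ‖ := by positivity
  have h2 : 0 < 1 + ‖η + ζ‖ := by positivity
  rw [Real.rpow_neg h2.le, Real.rpow_neg h1.le, ← div_eq_mul_inv,
    le_div_iff₀ (by positivity : 0 < (1 + ‖ζ‖) ^ m),
    inv_mul_le_iff₀ (by positivity : 0 < (1 + ‖η + ζ‖) ^ m),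
    ← Real.mul_rpow (by positivity) (by positivity)]
  exact Real.rpow_le_rpow h1.le ((one_add_norm_le_mul η ζ).trans_eq (mul_comm _ _)) hm

/-- A function which is smooth with compact support. -/
structure IsTestFn {n : ℕ} (f : Rn n → ℂ) : Prop where
  contDiff : ContDiff ℝ (⊤ : ℕ∞) f
  hasCompactSupport : HasCompactSupport f

namespace IsTestFn

variable {n : ℕ} {f g : Rn n → ℂ}

theorem integrable (hf : IsTestFn f) : Integrable f :=
  hf.contDiff.continuous.integrable_of_hasCompactSupport hf.hasCompactSupport

theorem mul_left (hf : IsTestFn f) (hg : ContDiff ℝ (⊤ : ℕ∞) g) : IsTestFn (fun x => g x * f x) :=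
  ⟨hg.mul hf.contDiff, hf.hasCompactSupport.mul_left⟩

end IsTestFn

/-- An `x`-derivative does not worsen the growth of a symbol in `ξ`, so integrating by parts once in
`x` gains `‖v‖⁻¹` at no cost. One power is enough, since the law of large numbers squares it. -/
theorem exists_norm_fourierInt_symbol_le {n : ℕ} {d : ℝ} {a : Rn n → Rn n → ℂ}
    (ha : ContDiff ℝ (⊤ : ℕ∞) fun z : Rn n × Rn n => a z.1 z.2) (hd : SymbolEstimates d univ a)
    {g : Rn n → ℂ} (hg : IsTestFn g) :
    ∃ C : ℝ, 0 ≤ C ∧ ∀ ξ v : Rn n, ‖fourierInt (fun x => a x ξ * g x) v‖ ≤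
      C * (1 + ‖ξ‖) ^ d * (1 + ‖v‖)⁻¹ := by
  obtain ⟨C₀, hC₀, h₀⟩ := hd.exists_norm_le
  obtain ⟨C₁, hC₁, h₁⟩ := hd.exists_norm_fderiv_le
  have hgi : Integrable fun x => ‖g x‖ := hg.integrable.norm
  have hgi' : Integrable fun x => ‖fderiv ℝ g x‖ :=
    ((hg.contDiff.continuous_fderiv (by simp)).integrable_of_hasCompactSupport
      (hg.hasCompactSupport.fderiv ℝ)).norm
  refine ⟨C₀ * (∫ x, ‖g x‖) + (C₀ * (∫ x, ‖fderiv ℝ g x‖) + C₁ * ∫ x, ‖g x‖), by positivity,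
    fun ξ v => ?_⟩
  have haξ : ContDiff ℝ (⊤ : ℕ∞) fun x => a x ξ := ha.comp (contDiff_id.prodMk contDiff_const)
  have hag := hg.mul_left haξ
  have h := one_add_norm_mul_norm_fourierInt_le (hag.contDiff.of_le (by simp))
    hag.hasCompactSupport v
  have hb1 : ∫ x, ‖a x ξ * g x‖ ≤ C₀ * (1 + ‖ξ‖) ^ d * ∫ x, ‖g x‖ := by
    rw [← integral_const_mul]
    refine integral_mono hag.integrable.norm (hgi.const_mul _) fun x => ?_
    simp only [norm_mul]
    exact mul_le_mul_of_nonneg_right (h₀ x ξ (mem_univ _)) (norm_nonneg _)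
  have hb2 : ∫ x, ‖fderiv ℝ (fun x => a x ξ * g x) x‖ ≤
      C₀ * (1 + ‖ξ‖) ^ d * (∫ x, ‖fderiv ℝ g x‖) + C₁ * (1 + ‖ξ‖) ^ d * ∫ x, ‖g x‖ := by
    rw [← integral_const_mul, ← integral_const_mul,
      ← integral_add (hgi'.const_mul _) (hgi.const_mul _)]
    refine integral_mono ((hag.contDiff.continuous_fderiv
      (by simp)).integrable_of_hasCompactSupport (hag.hasCompactSupport.fderiv ℝ)).norm
      ((hgi'.const_mul _).add (hgi.const_mul _)) fun x => ?_
    simp only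
    rw [fderiv_fun_mul ((haξ.differentiable (by simp)) x)
      ((hg.contDiff.differentiable (by simp)) x)]
    refine (norm_add_le _ _).trans (add_le_add ?_ ?_)
    · rw [norm_smul]
      exact mul_le_mul_of_nonneg_right (h₀ x ξ (mem_univ _)) (norm_nonneg _)
    · rw [norm_smul, mul_comm]
      exact mul_le_mul_of_nonneg_right (h₁ x ξ (mem_univ _)) (norm_nonneg _)
  have h0 : 0 < 1 + ‖v‖ := by positivity
  rw [← div_eq_mul_inv, le_div_iff₀ h0, mul_comm]
  linarith

/-- The pairing `⟨Op(a)(e^{i x·ζ} f), e^{i x·(v - ζ)} g⟩`, up to a constant factor. -/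
noncomputable def wavePairing {n : ℕ} (a : Rn n → Rn n → ℂ) (f g : Rn n → ℂ) (ζ v : Rn n) : ℂ :=
  ∫ η : Rn n, fourierInt f η * fourierInt (fun x => a x (η + ζ) * g x) (-(η + v))

/-- Peetre's inequality moves the shifts by `η` off `ζ` and `v`, at the price of `(1 + ‖η‖)^m` and
`1 + ‖η‖`. The rapid decay of `fourierInt f` absorbs the total weight `m + 1`. -/
theorem exists_norm_wavePairing_le {n : ℕ} {m : ℝ} (hm : 0 ≤ m) {a : Rn n → Rn n → ℂ}
    (ha : ContDiff ℝ (⊤ : ℕ∞) fun z : Rn n × Rn n => a z.1 z.2)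
    (hd : SymbolEstimates (-m) univ a) {f g : Rn n → ℂ} (hf : IsTestFn f) (hg : IsTestFn g) :
    ∃ C : ℝ, 0 ≤ C ∧ ∀ ζ v : Rn n, ‖wavePairing a f g ζ v‖ ≤
      C * (1 + ‖ζ‖) ^ (-m) * (1 + ‖v‖)⁻¹ := by
  obtain ⟨C, hC, h⟩ := exists_norm_fourierInt_symbol_le ha hd hg
  have hi := integrable_rpow_mul_norm_fourierInt hf.contDiff hf.hasCompactSupport (m + 1)
  refine ⟨C * ∫ η, (1 + ‖η‖) ^ (m + 1) * ‖fourierInt f η‖,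
    mul_nonneg hC (integral_nonneg fun η => by positivity), fun ζ v => ?_⟩
  have e : C * (∫ η, (1 + ‖η‖) ^ (m + 1) * ‖fourierInt f η‖) * (1 + ‖ζ‖) ^ (-m) * (1 + ‖v‖)⁻¹ =
      ∫ η, C * (1 + ‖ζ‖) ^ (-m) * (1 + ‖v‖)⁻¹ * ((1 + ‖η‖) ^ (m + 1) * ‖fourierInt f η‖) := by
    rw [integral_const_mul]
    ring
  rw [e]
  refine norm_integral_le_of_norm_le (hi.const_mul _) (ae_of_all _ fun η => ?_)
  have hη : 0 < 1 + ‖η‖ := by positivity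
  have hv : (1 + ‖η + v‖)⁻¹ ≤ (1 + ‖η‖) * (1 + ‖v‖)⁻¹ := by
    rw [← div_eq_mul_inv, le_div_iff₀ (by positivity), inv_mul_le_iff₀ (by positivity)]
    exact (one_add_norm_le_mul η v).trans_eq (mul_comm _ _)
  rw [norm_mul]
  calc ‖fourierInt f η‖ * ‖fourierInt (fun x => a x (η + ζ) * g x) (-(η + v))‖
      ≤ ‖fourierInt f η‖ * (C * ((1 + ‖η‖) ^ m * (1 + ‖ζ‖) ^ (-m)) *
          ((1 + ‖η‖) * (1 + ‖v‖)⁻¹)) := by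
        refine mul_le_mul_of_nonneg_left ((h _ _).trans ?_) (norm_nonneg _)
        rw [norm_neg]
        exact mul_le_mul (mul_le_mul_of_nonneg_left (one_add_norm_add_rpow_neg_le hm η ζ) hC) hv
          (by positivity) (by positivity)
    _ = _ := by
        rw [Real.rpow_add hη, Real.rpow_one]
        ring

theorem tendsto_norm_add_div {E : Type*} [SeminormedAddCommGroup E] {ζ : ℝ → E} {r : ℝ}
    (hζ : Tendsto (fun k => ‖ζ k‖ / k) atTop (𝓝 r)) (η : E) :
    Tendsto (fun k => ‖η + ζ k‖ / k) atTop (𝓝 r) := by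
  have h0 : Tendsto (fun k : ℝ => ‖η‖ / k) atTop (𝓝 0) := tendsto_const_nhds.div_atTop tendsto_id
  have h1 : Tendsto (fun k => ‖η + ζ k‖ / k - ‖ζ k‖ / k) atTop (𝓝 0) := by
    refine squeeze_zero_norm' ?_ h0
    filter_upwards [eventually_gt_atTop 0] with k hk
    rw [← sub_div, norm_div, Real.norm_of_nonneg hk.le]
    refine div_le_div_of_nonneg_right ?_ hk.le
    rw [Real.norm_eq_abs]
    simpa using abs_norm_sub_norm_le (η + ζ k) (ζ k)
  simpa using h1.add hζ

/-- The error has order `-m - 1`, so `k^m` times it is `O(1/‖ζ k‖)`. By homogeneity the principal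
part becomes `μ x` times `(‖ζ k‖ / k)^(-m)`. -/
theorem tendsto_symbol_of_principal {n : ℕ} {m : ℝ} (hm : 0 ≤ m) {a : Rn n → Rn n → ℂ} {μ : Rn n → ℝ}
    (hp : HasPrincipalSymbol (-m) a (fun x ξ => ((μ x * ‖ξ‖ ^ (-m) : ℝ) : ℂ)))
    {ζ : ℝ → Rn n} {r : ℝ} (hr : 0 < r) (hζ : Tendsto (fun k => ‖ζ k‖ / k) atTop (𝓝 r))
    (x : Rn n) :
    Tendsto (fun k : ℝ => ((k ^ m : ℝ) : ℂ) * a x (ζ k)) atTop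
      (𝓝 (((r ^ (-m) * μ x : ℝ)) : ℂ)) := by
  obtain ⟨C, hC, h⟩ := hp.exists_norm_le
  have hinf : Tendsto (fun k => ‖ζ k‖) atTop atTop := by
    have := hζ.pos_mul_atTop hr tendsto_id
    refine this.congr' ?_
    filter_upwards [eventually_gt_atTop 0] with k hk
    simp only [id]
    field_simp
  have hpow : Tendsto (fun k => (‖ζ k‖ / k) ^ (-m)) atTop (𝓝 (r ^ (-m))) :=
    hζ.rpow_const (Or.inl hr.ne')
  have hpow' : ∀ᶠ k : ℝ in atTop, (‖ζ k‖ / k) ^ (-m) = k ^ m * ‖ζ k‖ ^ (-m) := by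
    filter_upwards [eventually_gt_atTop 0] with k hk
    rw [Real.div_rpow (norm_nonneg _) hk.le, Real.rpow_neg hk.le, div_inv_eq_mul, mul_comm]
  have hrem : Tendsto (fun k : ℝ => ((k ^ m : ℝ) : ℂ) *
      (a x (ζ k) - ((μ x * ‖ζ k‖ ^ (-m) : ℝ) : ℂ))) atTop (𝓝 0) := by
    have hlim : Tendsto (fun k => C * ((‖ζ k‖ / k) ^ (-m) * ‖ζ k‖⁻¹)) atTop
        (𝓝 (C * (r ^ (-m) * 0))) := (hpow.mul hinf.inv_tendsto_atTop).const_mul C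
    rw [mul_zero, mul_zero] at hlim
    refine squeeze_zero_norm' ?_ hlim
    filter_upwards [hpow', eventually_gt_atTop 0, hinf.eventually_ge_atTop 1] with k hk hk0 hζ1
    have hz : 0 < ‖ζ k‖ := by linarith
    rw [hk, norm_mul, Complex.norm_real, Real.norm_of_nonneg (by positivity)]
    refine (mul_le_mul_of_nonneg_left (h x (ζ k) hζ1) (by positivity)).trans ?_
    have hle : (1 + ‖ζ k‖) ^ (-m - 1) ≤ ‖ζ k‖ ^ (-m) * ‖ζ k‖⁻¹ := by
      rw [← Real.rpow_neg_one ‖ζ k‖, ← Real.rpow_add hz, ← sub_eq_add_neg]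
      exact Real.rpow_le_rpow_of_nonpos hz (by linarith) (by linarith)
    calc k ^ m * (C * (1 + ‖ζ k‖) ^ (-m - 1))
        ≤ k ^ m * (C * (‖ζ k‖ ^ (-m) * ‖ζ k‖⁻¹)) := by gcongr
      _ = C * (k ^ m * ‖ζ k‖ ^ (-m) * ‖ζ k‖⁻¹) := by ring
  have := hrem.add (((Complex.continuous_ofReal.tendsto _).comp (hpow.mul_const (μ x))))
  rw [zero_add] at this
  refine this.congr' ?_
  filter_upwards [hpow'] with k hk
  simp only [Function.comp_apply]
  rw [hk]
  push_cast
  ring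

theorem integrable_fourierInt_mul_expWave_mul {n : ℕ} {f g : Rn n → ℂ} (hf : IsTestFn f)
    (hg : IsTestFn g) (v : Rn n) :
    Integrable (Function.uncurry fun η x => fourierInt f η * (expWave (η + v) x * g x))
      ((volume : Measure (Rn n)).prod volume) := by
  have h1 : Integrable (fun z : Rn n × Rn n => fourierInt f z.1 * g z.2)
      ((volume : Measure (Rn n)).prod volume) :=
    (integrable_fourierInt hf.contDiff hf.hasCompactSupport).mul_prod hg.integrable
  have hcw : Continuous fun z : Rn n × Rn n => expWave (z.1 + v) z.2 :=
    (continuous_fst.add continuous_const).expWave continuous_snd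
  have hcf := (continuous_fourierInt hf.contDiff hf.hasCompactSupport).comp
    (continuous_fst (X := Rn n) (Y := Rn n))
  have hcg := hg.contDiff.continuous.comp (continuous_snd (X := Rn n) (Y := Rn n))
  refine h1.mono (hcf.mul (hcw.mul hcg)).aestronglyMeasurable (ae_of_all _ fun z => ?_)
  rw [Function.uncurry, norm_mul, norm_mul, norm_mul, norm_expWave, one_mul]

/-- Dominated convergence is used in `x` and then in `η`. A fixed shift `η` does not change the rate
of `ζ k`, so the limiting symbol is independent of `η` and the `η`-integral collapses by Fourier
inversion to `(2π)^n f x`. -/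
theorem tendsto_wavePairing {n : ℕ} {m : ℝ} (hm : 0 ≤ m) {a : Rn n → Rn n → ℂ} {μ : Rn n → ℝ}
    (ha : ContDiff ℝ (⊤ : ℕ∞) fun z : Rn n × Rn n => a z.1 z.2)
    (hd : SymbolEstimates (-m) univ a)
    (hp : HasPrincipalSymbol (-m) a (fun x ξ => ((μ x * ‖ξ‖ ^ (-m) : ℝ) : ℂ)))
    (hμ : ContDiff ℝ (⊤ : ℕ∞) μ) {f g : Rn n → ℂ} (hf : IsTestFn f) (hg : IsTestFn g)
    {ζ : ℝ → Rn n} {r : ℝ} (hr : 1 < r) (hζ : Tendsto (fun k => ‖ζ k‖ / k) atTop (𝓝 r))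
    (v : Rn n) :
    Tendsto (fun k : ℝ => ((k ^ m : ℝ) : ℂ) * wavePairing a f g (ζ k) v) atTop
      (𝓝 (((r ^ (-m) * (2 * Real.pi) ^ n : ℝ) : ℂ) *
        ∫ x, expWave v x * (f x * g x * (μ x : ℂ)))) := by
  obtain ⟨C, hC, h⟩ := hd.exists_norm_le
  have hr0 : 0 < r := one_pos.trans hr
  -- This is where `r > 1` enters: it makes `k^m (1 + ‖ζ k‖)^(-m)` at most 1, so the dominating
  -- functions need no further constant.
  have hkζ : ∀ᶠ k in atTop, 0 < k ∧ k ≤ ‖ζ k‖ := by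
    filter_upwards [hζ.eventually (lt_mem_nhds hr), eventually_gt_atTop 0] with k h1 h2
    rw [lt_div_iff₀ h2, one_mul] at h1
    exact ⟨h2, h1.le⟩
  have hbound : ∀ᶠ k : ℝ in atTop, ∀ η x : Rn n,
      ‖((k ^ m : ℝ) : ℂ) * a x (η + ζ k)‖ ≤ C * (1 + ‖η‖) ^ m := by
    filter_upwards [hkζ] with k hk η x
    have h1 : k ^ m * (1 + ‖ζ k‖) ^ (-m) ≤ 1 := by
      rw [Real.rpow_neg (by positivity), ← div_eq_mul_inv]
      exact div_le_one_of_le₀ (Real.rpow_le_rpow hk.1.le (by linarith) hm) (by positivity)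
    rw [norm_mul, Complex.norm_real, Real.norm_of_nonneg (Real.rpow_nonneg hk.1.le _)]
    calc k ^ m * ‖a x (η + ζ k)‖
        ≤ k ^ m * (C * ((1 + ‖η‖) ^ m * (1 + ‖ζ k‖) ^ (-m))) := by
          refine mul_le_mul_of_nonneg_left ((h x _ (mem_univ _)).trans ?_)
            (Real.rpow_nonneg hk.1.le _)
          exact mul_le_mul_of_nonneg_left (one_add_norm_add_rpow_neg_le hm η (ζ k)) hC
      _ = C * (1 + ‖η‖) ^ m * (k ^ m * (1 + ‖ζ k‖) ^ (-m)) := by ring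
      _ ≤ C * (1 + ‖η‖) ^ m := mul_le_of_le_one_right (by positivity) h1
  have hgc := hg.contDiff.continuous
  have hinner : ∀ η : Rn n, Tendsto (fun k : ℝ => ((k ^ m : ℝ) : ℂ) *
      fourierInt (fun x => a x (η + ζ k) * g x) (-(η + v))) atTop
      (𝓝 (∫ x, expWave (η + v) x * (((r ^ (-m) * μ x : ℝ) : ℂ) * g x))) := by
    intro η
    have e : ∀ k : ℝ, ((k ^ m : ℝ) : ℂ) *
        fourierInt (fun x => a x (η + ζ k) * g x) (-(η + v)) =
        ∫ x, expWave (η + v) x * ((((k ^ m : ℝ) : ℂ) * a x (η + ζ k)) * g x) := by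
      intro k
      rw [fourierInt_eq_integral_expWave, neg_neg, ← integral_const_mul]
      congr 1
      ext x
      ring
    simp_rw [e]
    refine tendsto_integral_filter_of_dominated_convergence
      (fun x => C * (1 + ‖η‖) ^ m * ‖g x‖) ?_ ?_ (hg.integrable.norm.const_mul _) ?_
    · refine Eventually.of_forall fun k => Continuous.aestronglyMeasurable ?_
      have := ha.continuous.comp (Continuous.prodMk continuous_id
        (continuous_const (y := η + ζ k)))
      exact (continuous_const.expWave continuous_id).mul ((continuous_const.mul this).mul hgc)
    · filter_upwards [hbound] with k hk
      refine ae_of_all _ fun x => ?_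
      rw [norm_mul, norm_expWave, one_mul, norm_mul]
      exact mul_le_mul_of_nonneg_right (hk η x) (norm_nonneg _)
    · refine ae_of_all _ fun x => ?_
      exact ((tendsto_symbol_of_principal hm hp hr0 (tendsto_norm_add_div hζ η) x).mul_const
        (g x)).const_mul _
  have houter : Tendsto (fun k : ℝ => ((k ^ m : ℝ) : ℂ) * wavePairing a f g (ζ k) v) atTop
      (𝓝 (∫ η, fourierInt f η *
        ∫ x, expWave (η + v) x * (((r ^ (-m) * μ x : ℝ) : ℂ) * g x))) := by
    have e : ∀ k : ℝ, ((k ^ m : ℝ) : ℂ) * wavePairing a f g (ζ k) v =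
        ∫ η, fourierInt f η * (((k ^ m : ℝ) : ℂ) *
          fourierInt (fun x => a x (η + ζ k) * g x) (-(η + v))) := by
      intro k
      rw [wavePairing, ← integral_const_mul]
      congr 1
      ext x
      ring
    simp_rw [e]
    refine tendsto_integral_filter_of_dominated_convergence
      (fun η => (C * ∫ x, ‖g x‖) * ((1 + ‖η‖) ^ m * ‖fourierInt f η‖)) ?_ ?_
      ((integrable_rpow_mul_norm_fourierInt hf.contDiff hf.hasCompactSupport m).const_mul _) ?_
    · refine Eventually.of_forall fun k => ?_
      have hcont : Continuous fun z : Rn n × Rn n =>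
          expWave (z.1 + v) z.2 * (a z.2 (z.1 + ζ k) * g z.2) :=
        ((continuous_fst.add continuous_const).expWave continuous_snd).mul
          ((ha.continuous.comp (Continuous.prodMk continuous_snd (by fun_prop))).mul
            (hgc.comp continuous_snd))
      have hsm := hcont.stronglyMeasurable.integral_prod_right' (ν := (volume : Measure (Rn n)))
      refine (continuous_fourierInt hf.contDiff hf.hasCompactSupport).aestronglyMeasurable.mul
        (aestronglyMeasurable_const.mul ?_)
      simp_rw [fourierInt_eq_integral_expWave, neg_neg]
      exact hsm.aestronglyMeasurable
    · filter_upwards [hbound] with k hk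
      refine ae_of_all _ fun η => ?_
      have : ‖((k ^ m : ℝ) : ℂ) * fourierInt (fun x => a x (η + ζ k) * g x) (-(η + v))‖ ≤
          C * (1 + ‖η‖) ^ m * ∫ x, ‖g x‖ := by
        rw [fourierInt_eq_integral_expWave, ← integral_const_mul, ← integral_const_mul]
        refine norm_integral_le_of_norm_le (hg.integrable.norm.const_mul _)
          (ae_of_all _ fun x => ?_)
        rw [mul_left_comm, norm_mul, norm_expWave, one_mul, ← mul_assoc, norm_mul]
        exact mul_le_mul_of_nonneg_right (hk η x) (norm_nonneg _)
      rw [norm_mul]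
      exact (mul_le_mul_of_nonneg_left this (norm_nonneg _)).trans_eq (by ring)
    · exact ae_of_all _ fun η => (hinner η).const_mul _
  have hμg : IsTestFn fun x => ((r ^ (-m) * μ x : ℝ) : ℂ) * g x :=
    hg.mul_left (Complex.ofRealCLM.contDiff.comp (contDiff_const.mul hμ))
  convert houter using 2
  simp_rw [← integral_const_mul]
  rw [integral_integral_swap (integrable_fourierInt_mul_expWave_mul hf hμg v)]
  refine integral_congr_ae (ae_of_all _ fun x => ?_)
  have h1 := integral_exp_mul_fourierInt hf.contDiff hf.hasCompactSupport x
  have e : ∀ η, fourierInt f η * (expWave (η + v) x * (((r ^ (-m) * μ x : ℝ) : ℂ) * g x)) =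
      (expWave v x * ((r ^ (-m) * μ x : ℝ) : ℂ) * g x) *
        (Complex.exp (Complex.I * ((inner ℝ x η : ℝ) : ℂ)) * fourierInt f η) := by
    intro η
    rw [expWave_add]
    simp only [expWave]
    ring
  simp only
  simp_rw [e]
  rw [integral_const_mul, h1]
  push_cast
  ring

/-! ### The covariance in terms of the symbol -/

/-- The pairing `⟨Op(a) f, g⟩`, up to a constant factor. -/
noncomputable def symbolPairing {n : ℕ} (a : Rn n → Rn n → ℂ) (f g : Rn n → ℂ) : ℂ :=
  ∫ z : Rn n × Rn n, expWave z.2 z.1 * a z.1 z.2 * (fourierInt f z.2 * g z.1)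
    ∂((volume : Measure (Rn n)).prod volume)

theorem SymbolEstimates.exists_norm_le_const {n : ℕ} {m : ℝ} (hm : 0 ≤ m) {S : Set (Rn n)}
    {a : Rn n → Rn n → ℂ} (h : SymbolEstimates (-m) S a) :
    ∃ C : ℝ, ∀ x, ∀ ξ ∈ S, ‖a x ξ‖ ≤ C := by
  obtain ⟨C, hC0, hC⟩ := h.exists_norm_le
  refine ⟨C, fun x ξ hξ => (hC x ξ hξ).trans (mul_le_of_le_one_right hC0 ?_)⟩
  exact Real.rpow_le_one_of_one_le_of_nonpos (by linarith [norm_nonneg ξ]) (by linarith)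

section

variable {n : ℕ} {m : ℝ} {a : Rn n → Rn n → ℂ} {f g : Rn n → ℂ}

/-- A symbol of order `-m ≤ 0` is bounded, and `fourierInt f` and `g` are integrable. The double
integral therefore converges absolutely and may be taken in either order. -/
theorem integrable_symbolPairing (hm : 0 ≤ m)
    (ha : ContDiff ℝ (⊤ : ℕ∞) fun z : Rn n × Rn n => a z.1 z.2)
    (hd : SymbolEstimates (-m) univ a) (hf : IsTestFn f) (hg : IsTestFn g) :
    Integrable (fun z : Rn n × Rn n => expWave z.2 z.1 * a z.1 z.2 * (fourierInt f z.2 * g z.1))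
      ((volume : Measure (Rn n)).prod volume) := by
  obtain ⟨C, hC⟩ := hd.exists_norm_le_const hm
  have h1 : Integrable (fun z : Rn n × Rn n => fourierInt f z.2 * g z.1)
      ((volume : Measure (Rn n)).prod volume) :=
    (hg.integrable.mul_prod (integrable_fourierInt hf.contDiff hf.hasCompactSupport)).congr
      (ae_of_all _ fun z => mul_comm _ _)
  have hc : Continuous fun z : Rn n × Rn n => expWave z.2 z.1 * a z.1 z.2 :=
    (continuous_snd.expWave continuous_fst).mul ha.continuous
  refine h1.bdd_mul (c := C) hc.aestronglyMeasurable (ae_of_all _ fun z => ?_)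
  rw [norm_mul, norm_expWave, one_mul]
  exact hC _ _ (mem_univ _)

theorem fourierInt_add_mul {f₁ f₂ : Rn n → ℂ} (h₁ : Integrable f₁) (h₂ : Integrable f₂)
    (c₁ c₂ : ℂ) (ξ : Rn n) :
    fourierInt (fun x => c₁ * f₁ x + c₂ * f₂ x) ξ =
      c₁ * fourierInt f₁ ξ + c₂ * fourierInt f₂ ξ := by
  have hi : ∀ {f : Rn n → ℂ}, Integrable f → Integrable fun x => expWave (-ξ) x * f x := by
    intro f hf
    refine hf.bdd_mul (c := 1) (continuous_const.expWave continuous_id).aestronglyMeasurable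
      (ae_of_all _ fun z => (norm_expWave _ _).le)
  simp_rw [fourierInt_eq_integral_expWave]
  rw [← integral_const_mul, ← integral_const_mul,
    ← integral_add ((hi h₁).const_mul _) ((hi h₂).const_mul _)]
  congr 1
  ext x
  ring

theorem symbolPairing_add_mul_left (hm : 0 ≤ m)
    (ha : ContDiff ℝ (⊤ : ℕ∞) fun z : Rn n × Rn n => a z.1 z.2)
    (hd : SymbolEstimates (-m) univ a) {f₁ f₂ : Rn n → ℂ} (h₁ : IsTestFn f₁) (h₂ : IsTestFn f₂)
    (hg : IsTestFn g) (c₁ c₂ : ℂ) :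
    symbolPairing a (fun x => c₁ * f₁ x + c₂ * f₂ x) g =
      c₁ * symbolPairing a f₁ g + c₂ * symbolPairing a f₂ g := by
  simp only [symbolPairing]
  rw [← integral_const_mul, ← integral_const_mul,
    ← integral_add ((integrable_symbolPairing hm ha hd h₁ hg).const_mul _)
      ((integrable_symbolPairing hm ha hd h₂ hg).const_mul _)]
  congr 1
  ext z
  rw [fourierInt_add_mul h₁.integrable h₂.integrable]
  ring

theorem symbolPairing_add_mul_right (hm : 0 ≤ m)
    (ha : ContDiff ℝ (⊤ : ℕ∞) fun z : Rn n × Rn n => a z.1 z.2)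
    (hd : SymbolEstimates (-m) univ a) {g₁ g₂ : Rn n → ℂ} (h₁ : IsTestFn g₁) (h₂ : IsTestFn g₂)
    (hf : IsTestFn f) (c₁ c₂ : ℂ) :
    symbolPairing a f (fun x => c₁ * g₁ x + c₂ * g₂ x) =
      c₁ * symbolPairing a f g₁ + c₂ * symbolPairing a f g₂ := by
  simp only [symbolPairing]
  rw [← integral_const_mul, ← integral_const_mul,
    ← integral_add ((integrable_symbolPairing hm ha hd hf h₁).const_mul _)
      ((integrable_symbolPairing hm ha hd hf h₂).const_mul _)]
  congr 1
  ext z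
  ring

theorem IsTestFn.expWave_mul (hf : IsTestFn f) (ζ : Rn n) :
    IsTestFn fun x => expWave ζ x * f x :=
  hf.mul_left (contDiff_expWave ζ)

/-- Modulating `f` by `ζ` translates its transform. Undoing this by `η ↦ η + ζ` moves the frequency
into the symbol and leaves the total oscillation `η + ζ + ζ'`. -/
theorem symbolPairing_expWave (hm : 0 ≤ m)
    (ha : ContDiff ℝ (⊤ : ℕ∞) fun z : Rn n × Rn n => a z.1 z.2)
    (hd : SymbolEstimates (-m) univ a) (hf : IsTestFn f) (hg : IsTestFn g) (ζ ζ' : Rn n) :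
    symbolPairing a (fun x => expWave ζ x * f x) (fun x => expWave ζ' x * g x) =
      wavePairing a f g ζ (ζ + ζ') := by
  have hi := integrable_symbolPairing hm ha hd (hf.expWave_mul ζ) (hg.expWave_mul ζ')
  rw [symbolPairing, integral_prod_symm _ hi, wavePairing,
    ← integral_add_right_eq_self _ ζ]
  congr 1
  ext η
  simp only
  rw [fourierInt_expWave_mul, add_sub_cancel_right,
    fourierInt_eq_integral_expWave _ (-(η + (ζ + ζ'))), neg_neg,
    ← integral_const_mul]
  congr 1
  ext x
  rw [← add_assoc, expWave_add (η + ζ) ζ']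
  ring

theorem integral_pseudoDiffOp_mul (hm : 0 ≤ m)
    (ha : ContDiff ℝ (⊤ : ℕ∞) fun z : Rn n × Rn n => a z.1 z.2)
    (hd : SymbolEstimates (-m) univ a) (φ ψ : RealTest n)
    (hφ : IsTestFn fun x => ((φ x : ℝ) : ℂ)) (hψ : IsTestFn fun x => ((ψ x : ℝ) : ℂ)) :
    ∫ x : Rn n, pseudoDiffOp a φ x * ((ψ x : ℝ) : ℂ) =
      (((2 * Real.pi) ^ n : ℝ) : ℂ)⁻¹ *
        symbolPairing a (fun x => ((φ x : ℝ) : ℂ)) (fun x => ((ψ x : ℝ) : ℂ)) := by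
  rw [symbolPairing, integral_prod _ (integrable_symbolPairing hm ha hd hφ hψ),
    ← integral_const_mul]
  congr 1
  ext x
  rw [pseudoDiffOp, mul_assoc, ← integral_mul_const]
  congr 2
  ext ξ
  rw [fourierInt, ← mul_assoc, ← integral_const_mul, ← integral_mul_const, ← integral_mul_const]
  congr 1
  ext y
  have e : Complex.exp (Complex.I * ((inner ℝ (x - y) ξ : ℝ) : ℂ)) =
      expWave ξ x * Complex.exp (-(Complex.I * ((inner ℝ y ξ : ℝ) : ℂ))) := by
    rw [expWave, ← Complex.exp_add, inner_sub_left]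
    push_cast
    ring_nf
  rw [e]
  ring

end

theorem RealTest.isTestFn {n : ℕ} (φ : RealTest n) : IsTestFn fun x => ((φ x : ℝ) : ℂ) :=
  ⟨Complex.ofRealCLM.contDiff.comp φ.contDiff,
    φ.hasCompactSupport.comp_left (g := fun r : ℝ => (r : ℂ)) Complex.ofReal_zero⟩

/-! ### Real plane-wave test functions and their covariances -/

/-- The real test function `χ Re(κ e^{i x·ζ})`. -/
noncomputable def waveTest {n : ℕ} (χ : RealTest n) (κ : ℂ) (ζ : Rn n) : RealTest n where
  toFun y := χ y * (κ * expWave ζ y).re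
  contDiff' := χ.contDiff.mul
    (Complex.reCLM.contDiff.comp (contDiff_const.mul (contDiff_expWave ζ)))
  hasCompactSupport' := χ.hasCompactSupport.mul_right
  tsupport_subset' := fun _ _ => trivial

theorem waveTest_apply {n : ℕ} (χ : RealTest n) (κ : ℂ) (ζ y : Rn n) :
    waveTest χ κ ζ y = χ y * (κ * expWave ζ y).re := rfl

theorem conj_expWave {n : ℕ} (ζ x : Rn n) :
    (starRingEnd ℂ) (expWave ζ x) = expWave (-ζ) x := by
  simp [expWave, ← Complex.exp_conj, inner_neg_right]

theorem ofReal_waveTest {n : ℕ} (χ : RealTest n) (κ : ℂ) (ζ y : Rn n) :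
    ((waveTest χ κ ζ y : ℝ) : ℂ) = κ / 2 * (expWave ζ y * ((χ y : ℝ) : ℂ)) +
      (starRingEnd ℂ) κ / 2 * (expWave (-ζ) y * ((χ y : ℝ) : ℂ)) := by
  rw [waveTest_apply, Complex.ofReal_mul, Complex.re_eq_add_conj, map_mul, conj_expWave]
  ring

/-- Each real wave is half the sum of two conjugate exponentials, whence four terms. For nearby
frequencies, the two with `ζ - ζ'` up to sign carry the limit, while those with `ζ + ζ'` up to sign
oscillate and decay. -/
theorem covariance_waveTest {n : ℕ} {Ω : Type*} [MeasurableSpace Ω] {P : Measure Ω}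
    {q : Ω → RealTest n →ₗ[ℝ] ℝ} {m : ℝ} (hm : 0 ≤ m) {a : Rn n → Rn n → ℂ}
    (ha : ContDiff ℝ (⊤ : ℕ∞) fun z : Rn n × Rn n => a z.1 z.2)
    (hd : SymbolEstimates (-m) univ a) (hq : HasCovarianceSymbol P q a)
    (χ : RealTest n) (κ κ' : ℂ) (ζ ζ' : Rn n) :
    ((covariance (fun ω => q ω (waveTest χ κ ζ)) (fun ω => q ω (waveTest χ κ' ζ')) P : ℝ) : ℂ) =
      (((2 * Real.pi) ^ n : ℝ) : ℂ)⁻¹ * (1 / 4) *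
        (κ * κ' * wavePairing a (fun x => χ x) (fun x => χ x) ζ (ζ + ζ') +
         κ * (starRingEnd ℂ) κ' * wavePairing a (fun x => χ x) (fun x => χ x) ζ (ζ + -ζ') +
         (starRingEnd ℂ) κ * κ' * wavePairing a (fun x => χ x) (fun x => χ x) (-ζ) (-ζ + ζ') +
         (starRingEnd ℂ) κ * (starRingEnd ℂ) κ' *
           wavePairing a (fun x => χ x) (fun x => χ x) (-ζ) (-ζ + -ζ')) := by
  have hχ := RealTest.isTestFn χ
  have hφ' := RealTest.isTestFn (waveTest χ κ' ζ')
  rw [hq, integral_pseudoDiffOp_mul hm ha hd _ _ (RealTest.isTestFn _) hφ',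
    funext (ofReal_waveTest χ κ ζ),
    symbolPairing_add_mul_left hm ha hd (hχ.expWave_mul ζ) (hχ.expWave_mul (-ζ)) hφ',
    funext (ofReal_waveTest χ κ' ζ'),
    symbolPairing_add_mul_right hm ha hd (hχ.expWave_mul ζ') (hχ.expWave_mul (-ζ'))
      (hχ.expWave_mul ζ),
    symbolPairing_add_mul_right hm ha hd (hχ.expWave_mul ζ') (hχ.expWave_mul (-ζ'))
      (hχ.expWave_mul (-ζ)),
    symbolPairing_expWave hm ha hd hχ hχ, symbolPairing_expWave hm ha hd hχ hχ,
    symbolPairing_expWave hm ha hd hχ hχ, symbolPairing_expWave hm ha hd hχ hχ]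
  ring

/-! ### Continuity of the paths -/

/-- Partial derivatives in the second variable are restrictions of the joint derivative, hence
jointly continuous in parameter and point. -/
theorem iteratedFDeriv_comp_prodMk {E F G : Type*} [NormedAddCommGroup E] [NormedSpace ℝ E]
    [NormedAddCommGroup F] [NormedSpace ℝ F] [NormedAddCommGroup G] [NormedSpace ℝ G]
    {f : E × F → G} (hf : ContDiff ℝ (⊤ : ℕ∞) f) (i : ℕ) (s : E) (x : F) :
    iteratedFDeriv ℝ i (fun y => f (s, y)) x =
      (iteratedFDeriv ℝ i f (s, x)).compContinuousLinearMap
        fun _ => ContinuousLinearMap.inr ℝ E F := by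
  have h1 : (fun y => f (s, y)) = (fun z => f ((s, 0) + z)) ∘ ContinuousLinearMap.inr ℝ E F := by
    ext y
    simp
  have h2 : ContDiff ℝ (⊤ : ℕ∞) fun z => f ((s, 0) + z) :=
    hf.comp (contDiff_const.add contDiff_id)
  rw [h1, ContinuousLinearMap.iteratedFDeriv_comp_right _ h2 _ (i := i) (by exact_mod_cast le_top),
    iteratedFDeriv_comp_add_left]
  simp

/-- A generalized random function is almost surely continuous along a smooth family of test
functions supported in a common compact set. -/
theorem IsGeneralizedRandomFunction.ae_continuous {n : ℕ} {Ω : Type*} [MeasurableSpace Ω]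
    {P : Measure Ω} {q : Ω → RealTest n →ₗ[ℝ] ℝ} (hq : IsGeneralizedRandomFunction P q)
    {φ : ℝ → RealTest n} (hφ : ContDiff ℝ (⊤ : ℕ∞) fun z : ℝ × Rn n => φ z.1 z.2)
    {K : Set (Rn n)} (hK : IsCompact K) (hsupp : ∀ s, ∀ x ∉ K, φ s x = 0) :
    ∀ᵐ ω ∂P, Continuous fun s => q ω (φ s) := by
  obtain ⟨C, N, -, hC0, -, hb⟩ := hq.bound K hK
  have hts : ∀ s t, tsupport (φ t - φ s : RealTest n) ⊆ K := by
    intro s t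
    refine closure_minimal (fun x hx => ?_) hK.isClosed
    by_contra hxK
    refine hx ?_
    change φ t x - φ s x = 0
    rw [hsupp t x hxK, hsupp s x hxK, sub_zero]
  have hlim : ∀ i s, Tendsto (fun t => ⨆ x, ‖iteratedFDeriv ℝ i (φ t - φ s : RealTest n) x‖)
      (𝓝 s) (𝓝 0) := by
    intro i s
    set G : ℝ → Rn n → (Rn n) [×i]→L[ℝ] ℝ := fun t x => iteratedFDeriv ℝ i (φ t) x
    have hG : Continuous fun z : ℝ × Rn n => G z.1 z.2 := by
      have hD : Continuous (iteratedFDeriv ℝ i fun z : ℝ × Rn n => φ z.1 z.2) :=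
        hφ.continuous_iteratedFDeriv (by exact_mod_cast le_top)
      have hL := (ContinuousMultilinearMap.compContinuousLinearMapL (F := ℝ)
        (fun _ : Fin i => ContinuousLinearMap.inr ℝ ℝ (Rn n))).continuous
      refine (hL.comp hD).congr fun z => ?_
      exact (iteratedFDeriv_comp_prodMk hφ i z.1 z.2).symm
    have hsub : ∀ t x, iteratedFDeriv ℝ i (φ t - φ s : RealTest n) x = G t x - G s x := by
      intro t x
      change iteratedFDeriv ℝ i (⇑(φ t) - ⇑(φ s)) x = _
      exact iteratedFDeriv_sub_apply ((φ t).contDiff.contDiffAt.of_le (by exact_mod_cast le_top))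
        ((φ s).contDiff.contDiffAt.of_le (by exact_mod_cast le_top))
    rw [Metric.tendsto_nhds]
    intro ε hε
    -- Joint continuity and compactness of `K` give uniformity in `x`; outside `K` all derivatives
    -- of the difference vanish.
    have hev : ∀ᶠ t in 𝓝 s, ∀ x ∈ K, ‖G t x - G s x‖ < ε / 2 := by
      refine hK.eventually_forall_of_forall_eventually fun x _ => ?_
      have hc : Continuous fun z : ℝ × Rn n => ‖G z.1 z.2 - G s z.2‖ :=
        (hG.sub (hG.comp (continuous_const.prodMk continuous_snd))).norm
      have := hc.tendsto (s, x)
      simp only [sub_self, norm_zero] at this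
      exact this.eventually (gt_mem_nhds (half_pos hε))
    filter_upwards [hev] with t ht
    have hle : ⨆ x, ‖iteratedFDeriv ℝ i (φ t - φ s : RealTest n) x‖ ≤ ε / 2 := by
      refine Real.iSup_le (fun x => ?_) (half_pos hε).le
      by_cases hx : x ∈ K
      · rw [hsub]
        exact (ht x hx).le
      · have : iteratedFDeriv ℝ i (φ t - φ s : RealTest n) x = 0 := by
          by_contra hne
          exact hx (hts s t (support_iteratedFDeriv_subset i hne))
        rw [this, norm_zero]
        exact (half_pos hε).le
    rw [Real.dist_eq, sub_zero, abs_of_nonneg (Real.iSup_nonneg fun _ => norm_nonneg _)]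
    linarith
  filter_upwards [hb] with ω hω
  rw [continuous_iff_continuousAt]
  intro s
  rw [ContinuousAt, tendsto_iff_norm_sub_tendsto_zero]
  have hz : Tendsto (fun t => C ω * ∑ i ∈ Finset.range (N + 1),
      ⨆ x, ‖iteratedFDeriv ℝ i (φ t - φ s : RealTest n) x‖) (𝓝 s) (𝓝 0) := by
    have := (tendsto_finsetSum (Finset.range (N + 1)) fun i _ => hlim i s).const_mul (C ω)
    simpa using this
  refine squeeze_zero (fun _ => norm_nonneg _) (fun t => ?_) hz
  rw [← map_sub, Real.norm_eq_abs]
  exact hω _ (hts s t)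

theorem contDiff_waveTest {n : ℕ} (χ : RealTest n) (κ : ℂ) {ζ : ℝ → Rn n}
    (hζ : ContDiff ℝ (⊤ : ℕ∞) ζ) :
    ContDiff ℝ (⊤ : ℕ∞) fun z : ℝ × Rn n => waveTest χ κ (ζ z.1) z.2 := by
  have h1 : ContDiff ℝ (⊤ : ℕ∞) fun z : ℝ × Rn n => expWave (ζ z.1) z.2 :=
    contDiff_expWave_uncurry.comp ((hζ.comp contDiff_fst).prodMk contDiff_snd)
  exact (χ.contDiff.comp contDiff_snd).mul (Complex.reCLM.contDiff.comp (contDiff_const.mul h1))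

theorem waveTest_eq_zero {n : ℕ} (χ : RealTest n) (κ : ℂ) (ζ : Rn n) {x : Rn n}
    (hx : x ∉ tsupport χ) : waveTest χ κ ζ x = 0 := by
  rw [waveTest_apply, image_eq_zero_of_notMem_tsupport hx, zero_mul]

/-! ### From squares to products -/

/-- A law of large numbers for the products of two jointly Gaussian processes. -/
theorem ae_tendsto_average_mul {Ω : Type*} [MeasurableSpace Ω] {P : Measure Ω}
    [IsProbabilityMeasure P] {X Y : ℝ → Ω → ℝ}
    (hadd : IsGaussianProcess (fun k ω => X k ω + Y k ω) P)
    (hsub : IsGaussianProcess (fun k ω => X k ω - Y k ω) P)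
    (hXm : ∀ k, Measurable (X k)) (hYm : ∀ k, Measurable (Y k))
    (hX2 : ∀ k, MemLp (X k) 2 P) (hY2 : ∀ k, MemLp (Y k) 2 P)
    (hXc : ∀ᵐ ω ∂P, Continuous fun k => X k ω) (hYc : ∀ᵐ ω ∂P, Continuous fun k => Y k ω)
    {C : ℝ}
    (hXX : ∀ k, 1 ≤ k → ∀ l, 1 ≤ l → |∫ ω, X k ω * X l ω ∂P| ≤ C / (1 + |k - l|))
    (hXY : ∀ k, 1 ≤ k → ∀ l, 1 ≤ l → |∫ ω, X k ω * Y l ω ∂P| ≤ C / (1 + |k - l|))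
    (hYY : ∀ k, 1 ≤ k → ∀ l, 1 ≤ l → |∫ ω, Y k ω * Y l ω ∂P| ≤ C / (1 + |k - l|))
    {a b c : ℝ} (hlXX : Tendsto (fun k => ∫ ω, X k ω * X k ω ∂P) atTop (𝓝 a))
    (hlXY : Tendsto (fun k => ∫ ω, X k ω * Y k ω ∂P) atTop (𝓝 b))
    (hlYY : Tendsto (fun k => ∫ ω, Y k ω * Y k ω ∂P) atTop (𝓝 c)) :
    ∀ᵐ ω ∂P, Tendsto (fun K : ℝ => K⁻¹ * ∫ k in K..(2 * K), X k ω * Y k ω) atTop (𝓝 b) := by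
  have iXX : ∀ k l, Integrable (fun ω => X k ω * X l ω) P := fun k l =>
    (hX2 k).integrable_mul (hX2 l)
  have iXY : ∀ k l, Integrable (fun ω => X k ω * Y l ω) P := fun k l =>
    (hX2 k).integrable_mul (hY2 l)
  have iYY : ∀ k l, Integrable (fun ω => Y k ω * Y l ω) P := fun k l =>
    (hY2 k).integrable_mul (hY2 l)
  have eadd : ∀ k l, ∫ ω, (X k ω + Y k ω) * (X l ω + Y l ω) ∂P =
      (∫ ω, X k ω * X l ω ∂P) + (∫ ω, X k ω * Y l ω ∂P) + (∫ ω, X l ω * Y k ω ∂P) +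
        ∫ ω, Y k ω * Y l ω ∂P := by
    intro k l
    rw [← integral_add (iXX k l) (iXY k l), ← integral_add ((iXX k l).fun_add (iXY k l)) (iXY l k),
      ← integral_add (((iXX k l).fun_add (iXY k l)).fun_add (iXY l k)) (iYY k l)]
    congr 1
    ext ω
    ring
  have esub : ∀ k l, ∫ ω, (X k ω - Y k ω) * (X l ω - Y l ω) ∂P =
      (∫ ω, X k ω * X l ω ∂P) - ((∫ ω, X k ω * Y l ω ∂P) + (∫ ω, X l ω * Y k ω ∂P)) +
        ∫ ω, Y k ω * Y l ω ∂P := by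
    intro k l
    rw [← integral_add (iXY k l) (iXY l k), ← integral_sub (iXX k l) ((iXY k l).fun_add (iXY l k)),
      ← integral_add (f := fun ω => X k ω * X l ω - (X k ω * Y l ω + X l ω * Y k ω))
        ((iXX k l).sub ((iXY k l).fun_add (iXY l k))) (iYY k l)]
    congr 1
    ext ω
    ring
  have hbd : ∀ k, 1 ≤ k → ∀ l, 1 ≤ l → ∀ x y z w : ℝ, |x| ≤ C / (1 + |k - l|) →
      |y| ≤ C / (1 + |k - l|) → |z| ≤ C / (1 + |l - k|) → |w| ≤ C / (1 + |k - l|) →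
      |x| + |y| + |z| + |w| ≤ 4 * C / (1 + |k - l|) := by
    intro k _ l _ x y z w hx hy hz hw
    rw [abs_sub_comm l k] at hz
    rw [mul_div_assoc]
    linarith
  -- Polarization: `4XY = (X + Y)² - (X - Y)²`. The two squares have limits `a + 2b + c` and `a - 2b
  -- + c`, and each correlation is a sum of four terms bounded through `C`.
  have h1 := ae_tendsto_average_sq (C := 4 * C) (L := a + b + b + c) hadd
    (fun k => (hXm k).add (hYm k))
    (by filter_upwards [hXc, hYc] with ω h1 h2 using h1.add h2)
    (by
      intro k hk l hl
      rw [eadd]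
      refine le_trans ?_ (hbd k hk l hl _ _ _ _ (hXX k hk l hl) (hXY k hk l hl) (hXY l hl k hk)
        (hYY k hk l hl))
      exact (abs_add_le _ _).trans (add_le_add (abs_add_three _ _ _) le_rfl))
    (by
      refine (((hlXX.add hlXY).add hlXY).add hlYY).congr fun k => ?_
      rw [← eadd]
      simp only [sq])
  have h2 := ae_tendsto_average_sq (C := 4 * C) (L := a - (b + b) + c) hsub
    (fun k => (hXm k).sub (hYm k))
    (by filter_upwards [hXc, hYc] with ω h1 h2 using h1.sub h2)
    (by
      intro k hk l hl
      rw [esub]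
      refine le_trans ?_ (hbd k hk l hl _ _ _ _ (hXX k hk l hl) (hXY k hk l hl) (hXY l hl k hk)
        (hYY k hk l hl))
      refine (abs_add_le _ _).trans (add_le_add ?_ le_rfl)
      refine (abs_sub _ _).trans ?_
      rw [add_assoc]
      exact add_le_add le_rfl (abs_add_le _ _))
    (by
      refine ((hlXX.sub (hlXY.add hlXY)).add hlYY).congr fun k => ?_
      rw [← esub]
      simp only [sq])
  filter_upwards [h1, h2, hXc, hYc] with ω h1 h2 hx hy
  have h := (h1.sub h2).const_mul (1 / 4)
  rw [show 1 / 4 * (a + b + b + c - (a - (b + b) + c)) = b by ring] at h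
  refine h.congr fun K => ?_
  have c1 : Continuous fun k => (X k ω + Y k ω) ^ 2 := by fun_prop
  have c2 : Continuous fun k => (X k ω - Y k ω) ^ 2 := by fun_prop
  rw [← mul_sub, ← intervalIntegral.integral_sub (c1.intervalIntegrable _ _)
      (c2.intervalIntegrable _ _),
    mul_left_comm, ← intervalIntegral.integral_const_mul]
  congr 2
  ext k
  ring

/-! ### Second moments of the backscattering data -/

theorem one_add_rpow_neg_le_of_le {x y p : ℝ} (hx : 0 ≤ x) (hxy : x ≤ y) (hp : 0 ≤ p) :
    (1 + y) ^ (-p) ≤ (1 + x) ^ (-p) :=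
  Real.rpow_le_rpow_of_nonpos (by linarith) (by linarith) (by linarith)

theorem inv_mul_inv_le_inv_one_add_abs_sub {s t : ℝ} (hs : 0 ≤ s) (ht : 0 ≤ t) :
    (1 + s)⁻¹ * (1 + t)⁻¹ ≤ (1 + |s - t|)⁻¹ := by
  rw [← mul_inv]
  refine inv_anti₀ (by positivity) ?_
  have : |s - t| ≤ s + t := by
    rw [abs_le]
    constructor <;> linarith
  nlinarith [mul_nonneg hs ht]

theorem integral_mul_waveTest {n : ℕ} {f : Rn n → ℝ} (hf : ContDiff ℝ (⊤ : ℕ∞) f)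
    (χ : RealTest n) (κ : ℂ) (ζ : Rn n) :
    ∫ x, f x * waveTest χ κ ζ x =
      (κ * fourierInt (fun x => ((f x : ℝ) : ℂ) * ((χ x : ℝ) : ℂ)) (-ζ)).re := by
  have hfχ : IsTestFn fun x => ((f x : ℝ) : ℂ) * ((χ x : ℝ) : ℂ) :=
    (RealTest.isTestFn χ).mul_left (Complex.ofRealCLM.contDiff.comp hf)
  have hi : Integrable fun x => κ * (expWave ζ x * (((f x : ℝ) : ℂ) * ((χ x : ℝ) : ℂ))) :=
    (hfχ.expWave_mul ζ).integrable.const_mul κ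
  rw [fourierInt_eq_integral_expWave, neg_neg, ← integral_const_mul]
  have := integral_re hi
  simp only [RCLike.re_to_complex] at this
  rw [← this]
  congr 1
  ext x
  have e : κ * (expWave ζ x * (((f x : ℝ) : ℂ) * ((χ x : ℝ) : ℂ))) =
      ((f x * χ x : ℝ) : ℂ) * (κ * expWave ζ x) := by
    push_cast
    ring
  rw [e, Complex.re_ofReal_mul, waveTest_apply]
  ring

/-- The mean of the backscattering data decays rapidly. -/
theorem exists_abs_integral_waveTest_le {n : ℕ} {f : Rn n → ℝ} (hf : ContDiff ℝ (⊤ : ℕ∞) f)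
    (χ : RealTest n) (κ : ℂ) {p : ℝ} (hp : 0 ≤ p) {θ : Rn n} (hθ : ‖θ‖ = 1) :
    ∃ C : ℝ, 0 ≤ C ∧ ∀ s : ℝ, 0 ≤ s →
      |∫ x, f x * waveTest χ κ ((2 * s) • θ) x| ≤ C * (1 + s) ^ (-p) := by
  have hfχ : IsTestFn fun x => ((f x : ℝ) : ℂ) * ((χ x : ℝ) : ℂ) :=
    (RealTest.isTestFn χ).mul_left (Complex.ofRealCLM.contDiff.comp hf)
  obtain ⟨C, hC0, hC⟩ := exists_norm_fourierInt_le hfχ.contDiff hfχ.hasCompactSupport p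
  refine ⟨‖κ‖ * C, by positivity, fun s hs => ?_⟩
  rw [integral_mul_waveTest hf]
  refine (Complex.abs_re_le_norm _).trans ?_
  rw [norm_mul, mul_assoc]
  refine mul_le_mul_of_nonneg_left ((hC _).trans (mul_le_mul_of_nonneg_left ?_ hC0))
    (norm_nonneg _)
  rw [norm_neg, norm_smul, hθ, mul_one, Real.norm_of_nonneg (by linarith)]
  exact one_add_rpow_neg_le_of_le hs (by linarith) hp

/-- The standing assumptions on the second order structure of the field. -/
structure HasSymbolicMoments {n : ℕ} {Ω : Type*} [MeasurableSpace Ω] (P : Measure Ω)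
    (q : Ω → RealTest n →ₗ[ℝ] ℝ) (m : ℝ) (μ : Rn n → ℝ) (a : Rn n → Rn n → ℂ)
    (f : Rn n → ℝ) : Prop where
  memLp : ∀ φ : RealTest n, MemLp (fun ω => q ω φ) 2 P
  order_nonneg : 0 ≤ m
  smooth : ContDiff ℝ (⊤ : ℕ∞) fun z : Rn n × Rn n => a z.1 z.2
  estimates : SymbolEstimates (-m) univ a
  principal : HasPrincipalSymbol (-m) a (fun x ξ => ((μ x * ‖ξ‖ ^ (-m) : ℝ) : ℂ))
  covariance_symbol : HasCovarianceSymbol P q a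
  strength_smooth : ContDiff ℝ (⊤ : ℕ∞) μ
  mean_smooth : ContDiff ℝ (⊤ : ℕ∞) f
  mean : ∀ φ : RealTest n, ∫ ω, q ω φ ∂P = ∫ x, f x * φ x

namespace HasSymbolicMoments

variable {n : ℕ} {Ω : Type*} [MeasurableSpace Ω] {P : Measure Ω}
  {q : Ω → RealTest n →ₗ[ℝ] ℝ} {m : ℝ} {μ : Rn n → ℝ} {a : Rn n → Rn n → ℂ} {f : Rn n → ℝ}

theorem integral_mul_eq [IsProbabilityMeasure P] (h : HasSymbolicMoments P q m μ a f) (φ ψ : RealTest n) :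
    ∫ ω, q ω φ * q ω ψ ∂P = cov[fun ω => q ω φ, fun ω => q ω ψ; P] +
      (∫ x, f x * φ x) * ∫ x, f x * ψ x := by
  rw [covariance_eq_sub (h.memLp φ) (h.memLp ψ), h.mean, h.mean]
  simp

/-- In all four terms the first frequency has norm `2s ≥ s` and the total frequency has norm `2(s +
t)` or `2|s - t|`, hence at least `|s - t|`. One bound `B` serves for all of them. -/
theorem exists_abs_covariance_le (h : HasSymbolicMoments P q m μ a f) (χ : RealTest n)
    (κ κ' : ℂ) {θ : Rn n} (hθ : ‖θ‖ = 1) :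
    ∃ C : ℝ, 0 ≤ C ∧ ∀ s : ℝ, 0 ≤ s → ∀ t : ℝ, 0 ≤ t →
      |cov[fun ω => q ω (waveTest χ κ ((2 * s) • θ)),
        fun ω => q ω (waveTest χ κ' ((2 * t) • θ)); P]| ≤
        C * (1 + s) ^ (-m) * (1 + |s - t|)⁻¹ := by
  obtain ⟨C, hC0, hC⟩ := exists_norm_wavePairing_le h.order_nonneg h.smooth h.estimates
    (RealTest.isTestFn χ) (RealTest.isTestFn χ)
  refine ⟨‖((((2 * Real.pi) ^ n : ℝ) : ℂ)⁻¹ * (1 / 4))‖ * (4 * (‖κ‖ * ‖κ'‖) * C),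
    by positivity, fun s hs t ht => ?_⟩
  rw [← Real.norm_eq_abs, ← Complex.norm_real, covariance_waveTest h.order_nonneg h.smooth
    h.estimates h.covariance_symbol, norm_mul]
  set B := C * (1 + s) ^ (-m) * (1 + |s - t|)⁻¹ with hB
  refine le_trans (mul_le_mul_of_nonneg_left (c := 4 * (‖κ‖ * ‖κ'‖ * B)) ?_ (norm_nonneg _))
    (le_of_eq (by rw [hB]; ring))
  have hw : ∀ ζ v : Rn n, s ≤ ‖ζ‖ → |s - t| ≤ ‖v‖ →
      ‖wavePairing a (fun x => χ x) (fun x => χ x) ζ v‖ ≤ B := by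
    intro ζ v hζ hv
    refine (hC ζ v).trans ?_
    refine mul_le_mul (mul_le_mul_of_nonneg_left
      (one_add_rpow_neg_le_of_le hs hζ h.order_nonneg) hC0)
      (inv_anti₀ (by positivity) (by linarith)) (by positivity) (by positivity)
  have hn1 : s ≤ ‖(2 * s) • θ‖ := by
    rw [norm_smul, hθ, mul_one, Real.norm_of_nonneg (by linarith)]
    linarith
  have hn1' : s ≤ ‖-((2 * s) • θ)‖ := by rwa [norm_neg]
  have hst : |s - t| ≤ 2 * s + 2 * t := by
    rw [abs_le]
    constructor <;> linarith
  have hp : |s - t| ≤ ‖(2 * s) • θ + (2 * t) • θ‖ := by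
    rw [← add_smul, norm_smul, hθ, mul_one, Real.norm_of_nonneg (by linarith)]
    exact hst
  have hmn : |s - t| ≤ ‖(2 * s) • θ + -((2 * t) • θ)‖ := by
    rw [← sub_eq_add_neg, ← sub_smul, norm_smul, hθ, mul_one, ← mul_sub, norm_mul,
      Real.norm_two, Real.norm_eq_abs]
    linarith [abs_nonneg (s - t)]
  have hp' : |s - t| ≤ ‖-((2 * s) • θ) + -((2 * t) • θ)‖ := by
    rwa [← neg_add, norm_neg]
  have hmn' : |s - t| ≤ ‖-((2 * s) • θ) + (2 * t) • θ‖ := by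
    rw [← norm_neg, neg_add, neg_neg]
    exact hmn
  have b1 := hw _ _ hn1 hp
  have b2 := hw _ _ hn1 hmn
  have b3 := hw _ _ hn1' hmn'
  have b4 := hw _ _ hn1' hp'
  have e : ∀ (z w W : ℂ), ‖z‖ = ‖κ‖ → ‖w‖ = ‖κ'‖ → ‖W‖ ≤ B → ‖z * w * W‖ ≤ ‖κ‖ * ‖κ'‖ * B := by
    intro z w W hz hw hW
    rw [norm_mul, norm_mul, hz, hw]
    exact mul_le_mul_of_nonneg_left hW (by positivity)
  refine (norm_add₄_le).trans ?_
  have c1 := e κ κ' _ rfl rfl b1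
  have c2 := e κ (starRingEnd ℂ κ') _ rfl (RCLike.norm_conj _) b2
  have c3 := e (starRingEnd ℂ κ) κ' _ (RCLike.norm_conj _) rfl b3
  have c4 := e (starRingEnd ℂ κ) (starRingEnd ℂ κ') _ (RCLike.norm_conj _) (RCLike.norm_conj _) b4
  linarith

theorem exists_abs_mean_mul_le (h : HasSymbolicMoments P q m μ a f) (χ : RealTest n)
    (κ κ' : ℂ) {θ : Rn n} (hθ : ‖θ‖ = 1) :
    ∃ C : ℝ, 0 ≤ C ∧ ∀ s : ℝ, 0 ≤ s → ∀ t : ℝ, 0 ≤ t →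
      |(∫ x, f x * waveTest χ κ ((2 * s) • θ) x) * ∫ x, f x * waveTest χ κ' ((2 * t) • θ) x| ≤
        C * (1 + s) ^ (-m) * ((1 + s)⁻¹ * (1 + t)⁻¹) := by
  have hm := h.order_nonneg
  -- The exponents `m + 1` and 1 leave the weight `(1 + s)^(-m)` of the covariance bound, times `(1
  -- + s)⁻¹ (1 + t)⁻¹`, which is at most `(1 + |s - t|)⁻¹`.
  obtain ⟨C, hC0, hC⟩ := exists_abs_integral_waveTest_le h.mean_smooth χ κ
    (p := m + 1) (by linarith) hθ
  obtain ⟨C', hC0', hC'⟩ := exists_abs_integral_waveTest_le h.mean_smooth χ κ'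
    (p := 1) (by linarith) hθ
  refine ⟨C * C', by positivity, fun s hs t ht => ?_⟩
  rw [abs_mul]
  refine (mul_le_mul (hC s hs) (hC' t ht) (abs_nonneg _) (by positivity)).trans_eq ?_
  rw [neg_add, Real.rpow_add (by linarith), Real.rpow_neg_one, Real.rpow_neg_one]
  ring

theorem exists_abs_integral_mul_le [IsProbabilityMeasure P] (h : HasSymbolicMoments P q m μ a f) (χ : RealTest n)
    (κ κ' : ℂ) {θ : Rn n} (hθ : ‖θ‖ = 1) :
    ∃ C : ℝ, 0 ≤ C ∧ ∀ s : ℝ, 0 ≤ s → ∀ t : ℝ, 0 ≤ t →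
      |∫ ω, q ω (waveTest χ κ ((2 * s) • θ)) * q ω (waveTest χ κ' ((2 * t) • θ)) ∂P| ≤
        C * (1 + s) ^ (-m) * (1 + |s - t|)⁻¹ := by
  obtain ⟨C₁, hC₁, h₁⟩ := h.exists_abs_covariance_le χ κ κ' hθ
  obtain ⟨C₂, hC₂, h₂⟩ := h.exists_abs_mean_mul_le χ κ κ' hθ
  refine ⟨C₁ + C₂, by positivity, fun s hs t ht => ?_⟩
  rw [h.integral_mul_eq]
  refine (abs_add_le _ _).trans ?_
  rw [add_mul, add_mul]
  refine add_le_add (h₁ s hs t ht) ((h₂ s hs t ht).trans ?_)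
  exact mul_le_mul_of_nonneg_left (inv_mul_inv_le_inv_one_add_abs_sub hs ht) (by positivity)

/-- The correlations, normalized, decay off the diagonal. -/
theorem exists_abs_integral_mul_le_symm [IsProbabilityMeasure P] (h : HasSymbolicMoments P q m μ a f) (χ : RealTest n)
    (κ κ' : ℂ) {θ : Rn n} (hθ : ‖θ‖ = 1) :
    ∃ C : ℝ, 0 ≤ C ∧ ∀ s : ℝ, 0 ≤ s → ∀ t : ℝ, 0 ≤ t →
      (1 + s) ^ (m / 2) * (1 + t) ^ (m / 2) *
      |∫ ω, q ω (waveTest χ κ ((2 * s) • θ)) * q ω (waveTest χ κ' ((2 * t) • θ)) ∂P| ≤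
        C * (1 + |s - t|)⁻¹ := by
  -- The available bound is weighted in the first frequency only. It is applied in both orders, and
  -- `2xy ≤ x² + y²` with `x = (1 + s)^(m/2)`, `y = (1 + t)^(m/2)` makes it symmetric.
  obtain ⟨C₁, hC₁, h₁⟩ := h.exists_abs_integral_mul_le χ κ κ' hθ
  obtain ⟨C₂, hC₂, h₂⟩ := h.exists_abs_integral_mul_le χ κ' κ hθ
  refine ⟨C₁ + C₂, by positivity, fun s hs t ht => ?_⟩
  have b1 := h₁ s hs t ht
  have b2 := h₂ t ht s hs
  simp_rw [mul_comm (q _ (waveTest χ κ' _))] at b2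
  rw [abs_sub_comm t s] at b2
  set M := |∫ ω, q ω (waveTest χ κ ((2 * s) • θ)) * q ω (waveTest χ κ' ((2 * t) • θ)) ∂P|
  set w := (1 + |s - t|)⁻¹
  have hw : 0 ≤ w := by positivity
  have hM : 0 ≤ M := abs_nonneg _
  have key : ∀ x : ℝ, 0 ≤ x → ∀ D : ℝ, M ≤ D * (1 + x) ^ (-m) * w →
      ((1 + x) ^ (m / 2)) ^ 2 * M ≤ D * w := by
    intro x hx D hD
    have e : ((1 + x) ^ (m / 2)) ^ 2 * (1 + x) ^ (-m) = 1 := by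
      rw [← Real.rpow_natCast, ← Real.rpow_mul (by linarith), ← Real.rpow_add (by linarith)]
      have : m / 2 * ((2 : ℕ) : ℝ) + -m = 0 := by
        push_cast
        ring
      rw [this, Real.rpow_zero]
    calc ((1 + x) ^ (m / 2)) ^ 2 * M ≤ ((1 + x) ^ (m / 2)) ^ 2 * (D * (1 + x) ^ (-m) * w) :=
          mul_le_mul_of_nonneg_left hD (sq_nonneg _)
      _ = (((1 + x) ^ (m / 2)) ^ 2 * (1 + x) ^ (-m)) * (D * w) := by ring
      _ = D * w := by rw [e, one_mul]
  have k1 := key s hs C₁ b1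
  have k2 := key t ht C₂ b2
  have h3 : 0 ≤ ((1 + s) ^ (m / 2) - (1 + t) ^ (m / 2)) ^ 2 * M := by positivity
  have h4 : 0 ≤ C₁ * w := by positivity
  have h5 : 0 ≤ C₂ * w := by positivity
  nlinarith

end HasSymbolicMoments

/-! ### Limits of the rescaled second moments -/

theorem tendsto_const_mul_inv_one_add (C : ℝ) :
    Tendsto (fun k : ℝ => C * (1 + k)⁻¹) atTop (𝓝 0) := by
  have := (tendsto_inv_atTop_zero.comp (tendsto_atTop_add_const_left atTop 1
    (tendsto_id (α := ℝ)))).const_mul C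
  simpa using this

theorem rpow_mul_one_add_rpow_neg_le_one {k x m : ℝ} (hk : 0 ≤ k) (hx : k ≤ x) (hm : 0 ≤ m) :
    k ^ m * (1 + x) ^ (-m) ≤ 1 := by
  rw [Real.rpow_neg (by linarith), ← div_eq_mul_inv]
  exact div_le_one_of_le₀ (Real.rpow_le_rpow hk (by linarith) hm)
    (Real.rpow_nonneg (by linarith) _)

theorem tendsto_norm_smul_div {E : Type*} [NormedAddCommGroup E] [NormedSpace ℝ E] {θ : E}
    (hθ : ‖θ‖ = 1) {d : ℝ} (hd : 0 ≤ d) :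
    Tendsto (fun k : ℝ => ‖(2 * (k + d)) • θ‖ / k) atTop (𝓝 2) := by
  have h : Tendsto (fun k : ℝ => 2 + 2 * d / k) atTop (𝓝 (2 + 0)) :=
    (tendsto_const_nhds.div_atTop tendsto_id).const_add 2
  rw [add_zero] at h
  refine h.congr' ?_
  filter_upwards [eventually_gt_atTop 0] with k hk
  rw [norm_smul, hθ, mul_one, Real.norm_of_nonneg (by linarith)]
  field_simp

/-- This disposes of the terms whose total frequency grows with `k`: the factor `k^m` is spent on
the symbol, and the decay in `v` remains. -/
theorem tendsto_wavePairing_sum {n : ℕ} {m : ℝ} (hm : 0 ≤ m) {a : Rn n → Rn n → ℂ}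
    (ha : ContDiff ℝ (⊤ : ℕ∞) fun z : Rn n × Rn n => a z.1 z.2)
    (hd : SymbolEstimates (-m) univ a) {f g : Rn n → ℂ} (hf : IsTestFn f) (hg : IsTestFn g)
    {ζ v : ℝ → Rn n} (hζ : ∀ᶠ k in atTop, k ≤ ‖ζ k‖) (hv : ∀ᶠ k in atTop, k ≤ ‖v k‖) :
    Tendsto (fun k : ℝ => ((k ^ m : ℝ) : ℂ) * wavePairing a f g (ζ k) (v k)) atTop (𝓝 0) := by
  obtain ⟨C, hC0, hC⟩ := exists_norm_wavePairing_le hm ha hd hf hg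
  refine squeeze_zero_norm' ?_ (tendsto_const_mul_inv_one_add C)
  filter_upwards [hζ, hv, eventually_gt_atTop 0] with k h1 h2 hk
  rw [norm_mul, Complex.norm_real, Real.norm_of_nonneg (by positivity)]
  calc k ^ m * ‖wavePairing a f g (ζ k) (v k)‖
      ≤ k ^ m * (C * (1 + ‖ζ k‖) ^ (-m) * (1 + ‖v k‖)⁻¹) :=
        mul_le_mul_of_nonneg_left (hC _ _) (by positivity)
    _ = (k ^ m * (1 + ‖ζ k‖) ^ (-m)) * (C * (1 + ‖v k‖)⁻¹) := by ring
    _ ≤ 1 * (C * (1 + k)⁻¹) :=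
        mul_le_mul (rpow_mul_one_add_rpow_neg_le_one hk.le h1 hm)
          (mul_le_mul_of_nonneg_left (inv_anti₀ (by linarith) (by linarith)) hC0)
          (by positivity) zero_le_one
    _ = C * (1 + k)⁻¹ := one_mul _

namespace HasSymbolicMoments

variable {n : ℕ} {Ω : Type*} [MeasurableSpace Ω] {P : Measure Ω}
  {q : Ω → RealTest n →ₗ[ℝ] ℝ} {m : ℝ} {μ : Rn n → ℝ} {a : Rn n → Rn n → ℂ} {f : Rn n → ℝ}

/-- The two terms with frequency difference `±v` have complex conjugate limits. Together with the
factor `1/4` they give half a real part; `(2π)^n` cancels, and `2^(-m)` comes from `‖ζ k‖ / k → 2`.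
-/
theorem tendsto_covariance (h : HasSymbolicMoments P q m μ a f) (χ : RealTest n)
    (κ κ' : ℂ) {θ : Rn n} (hθ : ‖θ‖ = 1) {d d' : ℝ} (hd : 0 ≤ d) (hd' : 0 ≤ d') :
    Tendsto (fun k : ℝ => k ^ m * cov[fun ω => q ω (waveTest χ κ ((2 * (k + d)) • θ)),
        fun ω => q ω (waveTest χ κ' ((2 * (k + d')) • θ)); P]) atTop
      (𝓝 (1 / 2 * 2 ^ (-m) * (κ * (starRingEnd ℂ) κ' *
        ∫ x, expWave ((2 * (d - d')) • θ) x * (((χ x : ℝ) : ℂ) * ((χ x : ℝ) : ℂ) *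
          ((μ x : ℝ) : ℂ))).re)) := by
  have hχ := RealTest.isTestFn χ
  have hm := h.order_nonneg
  set M : Rn n → ℂ := fun v => ∫ x, expWave v x *
    (((χ x : ℝ) : ℂ) * ((χ x : ℝ) : ℂ) * ((μ x : ℝ) : ℂ)) with hM
  have hMneg : ∀ v, M (-v) = (starRingEnd ℂ) (M v) := by
    intro v
    simp only [hM]
    rw [← integral_conj]
    congr 1
    ext x
    simp only [map_mul, conj_expWave, Complex.conj_ofReal]
  set ζ : ℝ → Rn n := fun k => (2 * (k + d)) • θ with hζ
  set ζ' : ℝ → Rn n := fun k => (2 * (k + d')) • θ with hζ'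
  set v : Rn n := (2 * (d - d')) • θ with hv
  have e1 : ∀ k, ζ k + -ζ' k = v := by
    intro k
    simp only [hζ, hζ', hv]
    rw [← sub_eq_add_neg, ← sub_smul]
    congr 1
    ring
  have e2 : ∀ k, -ζ k + ζ' k = -v := by
    intro k
    rw [← e1 k, neg_add, neg_neg]
  have hζn : ∀ᶠ k in atTop, k ≤ ‖ζ k‖ := by
    filter_upwards [eventually_ge_atTop 0] with k hk
    rw [norm_smul, hθ, mul_one, Real.norm_of_nonneg (by linarith)]
    linarith
  have hsn : ∀ᶠ k in atTop, k ≤ ‖ζ k + ζ' k‖ := by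
    filter_upwards [eventually_ge_atTop 0] with k hk
    rw [← add_smul, norm_smul, hθ, mul_one, Real.norm_of_nonneg (by linarith)]
    linarith
  have t1 := tendsto_wavePairing_sum hm h.smooth h.estimates hχ hχ hζn hsn
  have t4 := tendsto_wavePairing_sum hm h.smooth h.estimates hχ hχ
    (ζ := fun k => -ζ k) (v := fun k => -ζ k + -ζ' k) (by simpa only [norm_neg] using hζn)
    (by simpa only [← neg_add, norm_neg] using hsn)
  have t2 := tendsto_wavePairing hm h.smooth h.estimates h.principal h.strength_smooth hχ hχ
    one_lt_two (tendsto_norm_smul_div hθ hd) v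
  have t3 := tendsto_wavePairing hm h.smooth h.estimates h.principal h.strength_smooth hχ hχ
    (ζ := fun k => -ζ k) one_lt_two
    (by simpa only [norm_neg] using tendsto_norm_smul_div hθ hd) (-v)
  have hlim := ((((t1.const_mul (κ * κ')).add (t2.const_mul (κ * (starRingEnd ℂ) κ'))).add
    (t3.const_mul ((starRingEnd ℂ) κ * κ'))).add
    (t4.const_mul ((starRingEnd ℂ) κ * (starRingEnd ℂ) κ'))).const_mul
    ((((2 * Real.pi) ^ n : ℝ) : ℂ)⁻¹ * (1 / 4))
  have hre := (Complex.continuous_re.tendsto _).comp hlim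
  have hpi : (((2 * Real.pi) ^ n : ℝ) : ℂ) ≠ 0 := by
    exact_mod_cast (by positivity : ((2 * Real.pi) ^ n : ℝ) ≠ 0)
  convert hre using 1
  · ext k
    have := covariance_waveTest hm h.smooth h.estimates h.covariance_symbol χ κ κ' (ζ k) (ζ' k)
    rw [← Complex.ofReal_re (k ^ m * _), Complex.ofReal_mul, this]
    simp only [Function.comp_apply]
    congr 1
    rw [e1, e2]
    ring
  · congr 1
    change _ = ((((2 * Real.pi) ^ n : ℝ) : ℂ)⁻¹ * (1 / 4) * (κ * κ' * 0 +
      κ * (starRingEnd ℂ) κ' * (((2 ^ (-m) * (2 * Real.pi) ^ n : ℝ) : ℂ) * M v) +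
      (starRingEnd ℂ) κ * κ' * (((2 ^ (-m) * (2 * Real.pi) ^ n : ℝ) : ℂ) * M (-v)) +
      (starRingEnd ℂ) κ * (starRingEnd ℂ) κ' * 0)).re
    rw [hMneg]
    have e : (((2 * Real.pi) ^ n : ℝ) : ℂ)⁻¹ * (1 / 4) * (κ * κ' * 0 +
      κ * (starRingEnd ℂ) κ' * (((2 ^ (-m) * (2 * Real.pi) ^ n : ℝ) : ℂ) * M v) +
      (starRingEnd ℂ) κ * κ' * (((2 ^ (-m) * (2 * Real.pi) ^ n : ℝ) : ℂ) *
        (starRingEnd ℂ) (M v)) +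
      (starRingEnd ℂ) κ * (starRingEnd ℂ) κ' * 0) =
      ((1 / 2 * 2 ^ (-m) : ℝ) : ℂ) * ((κ * (starRingEnd ℂ) κ' * M v +
        (starRingEnd ℂ) (κ * (starRingEnd ℂ) κ' * M v)) / 2) := by
      rw [Complex.ofReal_mul (2 ^ (-m))]
      simp only [map_mul, Complex.conj_conj]
      field_simp
      push_cast
      ring
    rw [e, ← Complex.re_eq_add_conj, Complex.re_ofReal_mul, Complex.ofReal_re]

theorem tendsto_integral_mul [IsProbabilityMeasure P] (h : HasSymbolicMoments P q m μ a f)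
    (χ : RealTest n) (κ κ' : ℂ) {θ : Rn n} (hθ : ‖θ‖ = 1) {d d' : ℝ} (hd : 0 ≤ d)
    (hd' : 0 ≤ d') :
    Tendsto (fun k : ℝ => k ^ m * ∫ ω, q ω (waveTest χ κ ((2 * (k + d)) • θ)) *
        q ω (waveTest χ κ' ((2 * (k + d')) • θ)) ∂P) atTop
      (𝓝 (1 / 2 * 2 ^ (-m) * (κ * (starRingEnd ℂ) κ' *
        ∫ x, expWave ((2 * (d - d')) • θ) x * (((χ x : ℝ) : ℂ) * ((χ x : ℝ) : ℂ) *
          ((μ x : ℝ) : ℂ))).re)) := by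
  obtain ⟨C, hC0, hC⟩ := h.exists_abs_mean_mul_le χ κ κ' hθ
  have hmean : Tendsto (fun k : ℝ => k ^ m *
      ((∫ x, f x * waveTest χ κ ((2 * (k + d)) • θ) x) *
        ∫ x, f x * waveTest χ κ' ((2 * (k + d')) • θ) x)) atTop (𝓝 0) := by
    refine squeeze_zero_norm' ?_ (tendsto_const_mul_inv_one_add C)
    filter_upwards [eventually_gt_atTop 0] with k hk
    rw [norm_mul, Real.norm_of_nonneg (by positivity), Real.norm_eq_abs]
    calc k ^ m * |_| ≤ k ^ m * (C * (1 + (k + d)) ^ (-m) *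
          ((1 + (k + d))⁻¹ * (1 + (k + d'))⁻¹)) :=
          mul_le_mul_of_nonneg_left (hC _ (by linarith) _ (by linarith)) (by positivity)
      _ = (k ^ m * (1 + (k + d)) ^ (-m)) * (C * ((1 + (k + d))⁻¹ * (1 + (k + d'))⁻¹)) := by ring
      _ ≤ 1 * (C * ((1 + k)⁻¹ * 1)) := by
          refine mul_le_mul (rpow_mul_one_add_rpow_neg_le_one hk.le (by linarith)
            h.order_nonneg) (mul_le_mul_of_nonneg_left (mul_le_mul
              (inv_anti₀ (by linarith) (by linarith)) (inv_le_one_of_one_le₀ (by linarith))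
              (by positivity) (by positivity)) hC0) (by positivity) zero_le_one
      _ = C * (1 + k)⁻¹ := by ring
  have := (h.tendsto_covariance χ κ κ' hθ hd hd').add hmean
  rw [add_zero] at this
  refine this.congr fun k => ?_
  rw [h.integral_mul_eq]
  ring

end HasSymbolicMoments

/-! ### The single backscattering -/

namespace HasSymbolicMoments

variable {n : ℕ} {Ω : Type*} [MeasurableSpace Ω] {P : Measure Ω}
  {q : Ω → RealTest n →ₗ[ℝ] ℝ} {m : ℝ} {μ : Rn n → ℝ} {a : Rn n → Rn n → ℂ} {f : Rn n → ℝ}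

theorem exists_abs_integral_normalized_le [IsProbabilityMeasure P]
    (h : HasSymbolicMoments P q m μ a f) (χ : RealTest n) (κ κ' : ℂ) {θ : Rn n} (hθ : ‖θ‖ = 1)
    {d d' : ℝ} (hd : 0 ≤ d) (hd' : 0 ≤ d') :
    ∃ C : ℝ, 0 ≤ C ∧ ∀ k : ℝ, 1 ≤ k → ∀ l : ℝ, 1 ≤ l →
      |∫ ω, (k ^ (m / 2) * q ω (waveTest χ κ ((2 * (k + d)) • θ))) *
        (l ^ (m / 2) * q ω (waveTest χ κ' ((2 * (l + d')) • θ))) ∂P| ≤ C / (1 + |k - l|) := by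
  obtain ⟨C, hC0, hC⟩ := h.exists_abs_integral_mul_le_symm χ κ κ' hθ
  have hm := h.order_nonneg
  -- The extra factor compares `|k - l|` with the distance between the shifted frequencies `k + d`
  -- and `l + d'`.
  refine ⟨C * (1 + |d - d'|), by positivity, fun k hk l hl => ?_⟩
  have e : ∀ ω, (k ^ (m / 2) * q ω (waveTest χ κ ((2 * (k + d)) • θ))) *
        (l ^ (m / 2) * q ω (waveTest χ κ' ((2 * (l + d')) • θ))) =
      k ^ (m / 2) * l ^ (m / 2) * (q ω (waveTest χ κ ((2 * (k + d)) • θ)) *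
        q ω (waveTest χ κ' ((2 * (l + d')) • θ))) := fun ω => by ring
  simp_rw [e]
  rw [integral_const_mul, abs_mul, abs_of_nonneg (by positivity)]
  have h1 := hC (k + d) (by linarith) (l + d') (by linarith)
  have h2 : k ^ (m / 2) * l ^ (m / 2) ≤ (1 + (k + d)) ^ (m / 2) * (1 + (l + d')) ^ (m / 2) :=
    mul_le_mul (Real.rpow_le_rpow (by linarith) (by linarith) (by linarith))
      (Real.rpow_le_rpow (by linarith) (by linarith) (by linarith)) (by positivity)
      (by positivity)
  refine (mul_le_mul_of_nonneg_right h2 (abs_nonneg _)).trans (h1.trans ?_)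
  have h3 : |k - l| ≤ |k + d - (l + d')| + |d - d'| := by
    have : k - l = (k + d - (l + d')) - (d - d') := by ring
    rw [this]
    exact abs_sub _ _
  rw [mul_div_assoc]
  refine mul_le_mul_of_nonneg_left ?_ hC0
  rw [le_div_iff₀ (by positivity), inv_mul_le_iff₀ (by positivity)]
  nlinarith [abs_nonneg (k + d - (l + d')), abs_nonneg (d - d')]

end HasSymbolicMoments

/-! ### Almost sure limits for the scattering data -/

section

variable {n : ℕ} {Ω : Type*} [MeasurableSpace Ω] {P : Measure Ω}
  {q : Ω → RealTest n →ₗ[ℝ] ℝ} {m : ℝ} {μ : Rn n → ℝ} {a : Rn n → Rn n → ℂ} {f : Rn n → ℝ}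

theorem ae_continuous_waveTest (hq : IsGaussianGeneralizedRandomFunction P q) (χ : RealTest n)
    (κ : ℂ) (θ : Rn n) (d : ℝ) :
    ∀ᵐ ω ∂P, Continuous fun k : ℝ => q ω (waveTest χ κ ((2 * (k + d)) • θ)) :=
  hq.toIsGeneralizedRandomFunction.ae_continuous
    (contDiff_waveTest χ κ (ζ := fun k => (2 * (k + d)) • θ) (by fun_prop))
    χ.hasCompactSupport fun _ _ hx => waveTest_eq_zero χ κ _ hx

theorem ae_tendsto_average_waveTest [IsProbabilityMeasure P]
    (hq : IsGaussianGeneralizedRandomFunction P q)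
    (h : HasSymbolicMoments P q m μ a f) (χ : RealTest n) (κ κ' : ℂ) {θ : Rn n} (hθ : ‖θ‖ = 1)
    {d d' : ℝ} (hd : 0 ≤ d) (hd' : 0 ≤ d') :
    ∀ᵐ ω ∂P, Tendsto (fun K : ℝ => K⁻¹ * ∫ k in K..(2 * K),
        k ^ m * (q ω (waveTest χ κ ((2 * (k + d)) • θ)) *
          q ω (waveTest χ κ' ((2 * (k + d')) • θ)))) atTop
      (𝓝 (1 / 2 * 2 ^ (-m) * (κ * (starRingEnd ℂ) κ' *
        ∫ x, expWave ((2 * (d - d')) • θ) x * (((χ x : ℝ) : ℂ) * ((χ x : ℝ) : ℂ) *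
          ((μ x : ℝ) : ℂ))).re)) := by
  have hm := h.order_nonneg
  have hpc : Continuous fun k : ℝ => k ^ (m / 2) :=
    Real.continuous_rpow_const (by linarith)
  have hpow : ∀ k : ℝ, 0 < k → k ^ (m / 2) * k ^ (m / 2) = k ^ m := fun k hk => by
    rw [← Real.rpow_add hk, add_halves]
  have hlim : ∀ (κ κ' : ℂ) {d d' : ℝ}, 0 ≤ d → 0 ≤ d' → ∃ L, Tendsto (fun k : ℝ =>
      ∫ ω, (k ^ (m / 2) * q ω (waveTest χ κ ((2 * (k + d)) • θ))) *
        (k ^ (m / 2) * q ω (waveTest χ κ' ((2 * (k + d')) • θ))) ∂P) atTop (𝓝 L) ∧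
      L = (1 / 2 * 2 ^ (-m) * (κ * (starRingEnd ℂ) κ' *
        ∫ x, expWave ((2 * (d - d')) • θ) x * (((χ x : ℝ) : ℂ) * ((χ x : ℝ) : ℂ) *
          ((μ x : ℝ) : ℂ))).re) := by
    intro κ κ' d d' hd hd'
    refine ⟨_, (h.tendsto_integral_mul χ κ κ' hθ hd hd').congr' ?_, rfl⟩
    filter_upwards [eventually_gt_atTop 0] with k hk
    rw [← hpow k hk, ← integral_const_mul]
    congr 1
    ext ω
    ring
  -- The limits of the two variances need only exist, since they cancel in the polarization.
  obtain ⟨_, l1, -⟩ := hlim κ κ hd hd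
  obtain ⟨L, l2, hL⟩ := hlim κ κ' hd hd'
  obtain ⟨_, l3, -⟩ := hlim κ' κ' hd' hd'
  obtain ⟨C₁, hC₁, b1⟩ := h.exists_abs_integral_normalized_le χ κ κ hθ hd hd
  obtain ⟨C₂, hC₂, b2⟩ := h.exists_abs_integral_normalized_le χ κ κ' hθ hd hd'
  obtain ⟨C₃, hC₃, b3⟩ := h.exists_abs_integral_normalized_le χ κ' κ' hθ hd' hd'
  have hG : ∀ φ : ℝ → RealTest n, IsGaussianProcess (fun k ω => q ω (φ k)) P := fun φ =>
    hq.gaussian.comp_right φ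
  have key := ae_tendsto_average_mul (P := P)
    (X := fun k ω => k ^ (m / 2) * q ω (waveTest χ κ ((2 * (k + d)) • θ)))
    (Y := fun k ω => k ^ (m / 2) * q ω (waveTest χ κ' ((2 * (k + d')) • θ)))
    (C := C₁ + C₂ + C₃)
    -- By linearity of `q`, the sum and the difference of the two processes are again pairings with
    -- test functions, so they are Gaussian processes.
    (by
      convert hG fun k => k ^ (m / 2) • waveTest χ κ ((2 * (k + d)) • θ) +
        k ^ (m / 2) • waveTest χ κ' ((2 * (k + d')) • θ) using 3
      rw [map_add, map_smul, map_smul, smul_eq_mul, smul_eq_mul])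
    (by
      convert hG fun k => k ^ (m / 2) • waveTest χ κ ((2 * (k + d)) • θ) -
        k ^ (m / 2) • waveTest χ κ' ((2 * (k + d')) • θ) using 3
      rw [map_sub, map_smul, map_smul, smul_eq_mul, smul_eq_mul])
    (fun k => (hq.measurable_apply _).const_mul _) (fun k => (hq.measurable_apply _).const_mul _)
    (fun k => (h.memLp _).const_mul _) (fun k => (h.memLp _).const_mul _)
    (by filter_upwards [ae_continuous_waveTest hq χ κ θ d] with ω hω using hpc.mul hω)
    (by filter_upwards [ae_continuous_waveTest hq χ κ' θ d'] with ω hω using hpc.mul hω)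
    (fun k hk l hl => (b1 k hk l hl).trans
      (div_le_div_of_nonneg_right (by linarith) (by positivity)))
    (fun k hk l hl => (b2 k hk l hl).trans
      (div_le_div_of_nonneg_right (by linarith) (by positivity)))
    (fun k hk l hl => (b3 k hk l hl).trans
      (div_le_div_of_nonneg_right (by linarith) (by positivity)))
    l1 l2 l3
  rw [← hL]
  filter_upwards [key] with ω hω
  refine hω.congr' ?_
  filter_upwards [eventually_gt_atTop 0] with K hK
  congr 1
  refine intervalIntegral.integral_congr fun k hk => ?_
  rw [uIcc_of_le (by linarith)] at hk
  rw [← hpow k (hK.trans_le hk.1)]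
  ring

end

/-- The single backscattering in terms of the real and imaginary parts of the data. -/
theorem singleScatteringFarField_back_eq {n : ℕ} (c : ℂ) (V : RealTest n →ₗ[ℝ] ℝ)
    (χ : RealTest n) (k : ℝ) (θ : Rn n) :
    singleScatteringFarField c V χ k θ (-θ) =
      c * (((V (waveTest χ 1 ((2 * k) • θ)) : ℝ) : ℂ) +
        Complex.I * ((V (waveTest χ (-Complex.I) ((2 * k) • θ)) : ℝ) : ℂ)) := by
  have hw : ∀ y : Rn n, planeWave k (-(-θ)) y * planeWave k θ y = expWave ((2 * k) • θ) y := by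
    intro y
    rw [neg_neg, planeWave, ← Complex.exp_add, expWave, inner_smul_right, real_inner_comm]
    congr 1
    push_cast
    ring
  rw [singleScatteringFarField, complexPairing]
  congr 5
  · ext y
    rw [TestFunction.postcompCLM_apply, waveTest_apply]
    change (((χ y : ℝ)) • (planeWave k (-(-θ)) y * planeWave k θ y)).re = _
    rw [hw, Complex.smul_re, one_mul, smul_eq_mul]
  -- The imaginary part is the real part after multiplication by `-i`, which is why the sine data
  -- uses `κ = -i`.
  · ext y
    rw [TestFunction.postcompCLM_apply, waveTest_apply]
    change (((χ y : ℝ)) • (planeWave k (-(-θ)) y * planeWave k θ y)).im = _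
    rw [hw, Complex.smul_im, smul_eq_mul]
    simp

theorem backscatteringCorrelation_eq {n : ℕ} (c : ℂ) (V : RealTest n →ₗ[ℝ] ℝ) (χ : RealTest n)
    (m τ : ℝ) (θ : Rn n) (k : ℝ) :
    backscatteringCorrelation c V χ m τ θ k = ((‖c‖ ^ 2 : ℝ) : ℂ) *
      (((k ^ m * (V (waveTest χ 1 ((2 * (k + 0)) • θ)) *
          V (waveTest χ 1 ((2 * (k + τ)) • θ))) : ℝ) : ℂ) +
        ((k ^ m * (V (waveTest χ (-Complex.I) ((2 * (k + 0)) • θ)) *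
          V (waveTest χ (-Complex.I) ((2 * (k + τ)) • θ))) : ℝ) : ℂ) +
        Complex.I * (((k ^ m * (V (waveTest χ (-Complex.I) ((2 * (k + 0)) • θ)) *
          V (waveTest χ 1 ((2 * (k + τ)) • θ))) : ℝ) : ℂ) -
        ((k ^ m * (V (waveTest χ 1 ((2 * (k + 0)) • θ)) *
          V (waveTest χ (-Complex.I) ((2 * (k + τ)) • θ))) : ℝ) : ℂ))) := by
  rw [backscatteringCorrelation, singleScatteringFarField_back_eq,
    singleScatteringFarField_back_eq, add_zero]
  have hc : c * (starRingEnd ℂ) c = ((‖c‖ ^ 2 : ℝ) : ℂ) := by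
    rw [Complex.mul_conj, Complex.normSq_eq_norm_sq]
  simp only [map_mul, map_add, Complex.conj_I, Complex.conj_ofReal]
  rw [← hc]
  push_cast
  linear_combination (-((k ^ m : ℝ) : ℂ) * c * (starRingEnd ℂ) c *
    (V (waveTest χ (-Complex.I) ((2 * k) • θ)) : ℂ) *
    (V (waveTest χ (-Complex.I) ((2 * (k + τ)) • θ)) : ℂ)) * Complex.I_sq

/-- The powers `(2π)^(n/2)` and `(2π)^(-n/2)` cancel, and the sign of `0 - τ` turns `expWave` into
the kernel of the Fourier transform. -/
theorem backscatteringConst_mul_unitaryFourier {n : ℕ} (c : ℂ) (m τ : ℝ) (μ : Rn n → ℝ)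
    (θ : Rn n) :
    (backscatteringConst c n m : ℂ) * unitaryFourier μ ((2 * τ) • θ) =
      ((‖c‖ ^ 2 * 2 ^ (-m) : ℝ) : ℂ) *
        ∫ x, expWave ((2 * (0 - τ)) • θ) x * ((μ x : ℝ) : ℂ) := by
  have e : ∫ x : Rn n, Complex.exp (-(Complex.I * ((inner ℝ ((2 * τ) • θ) x : ℝ) : ℂ))) *
      ((μ x : ℝ) : ℂ) = ∫ x, expWave ((2 * (0 - τ)) • θ) x * ((μ x : ℝ) : ℂ) := by
    congr 1
    ext x
    rw [expWave, zero_sub, mul_neg, neg_smul, inner_neg_right, real_inner_comm]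
    push_cast
    ring_nf
  rw [unitaryFourier, e, backscatteringConst, ← mul_assoc, ← Complex.ofReal_mul]
  congr 2
  rw [mul_assoc, ← Real.rpow_add (by positivity), add_neg_cancel, Real.rpow_zero, mul_one]

theorem mainTheorem3 {n : ℕ} (hn : 2 ≤ n)
    {Ω : Type*} [MeasurableSpace Ω] (P : Measure Ω) [IsProbabilityMeasure P]
    (D : Set (Rn n)) (hD_open : IsOpen D) (hD_bounded : Bornology.IsBounded D)
    (m : ℝ) (μ : Rn n → ℝ) (q : Ω → RealTest n →ₗ[ℝ] ℝ)
    (hq : IsGaussianGeneralizedRandomFunction P q)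
    (hq_iso : IsMicrolocallyIsotropic P q D m μ)
    (c : ℂ) (χ : RealTest n) (hχ : ∀ x ∈ D, χ x = 1)
    (τ : ℝ) (hτ : 0 ≤ τ) (θ : Rn n) (hθ : ‖θ‖ = 1) :
    ∀ᵐ ω ∂P,
      (∀ K : ℝ, 0 < K →
        IntervalIntegrable (backscatteringCorrelation c (q ω) χ m τ θ) volume K (2 * K)) ∧
      Tendsto
        (fun K : ℝ => ((1 / K : ℝ) : ℂ) *
          ∫ k in K..(2 * K), backscatteringCorrelation c (q ω) χ m τ θ k)
        atTop
        (𝓝 ((backscatteringConst c n m : ℂ) * unitaryFourier μ ((2 * τ) • θ))) := by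
  obtain ⟨a, ha, hp, hcov⟩ := hq_iso.covariance_symbol
  obtain ⟨f, hf, hmean⟩ := hq_iso.mean_smooth
  have hm : 0 ≤ m := by
    have h1 := hq_iso.lt_order
    have h2 : (2 : ℝ) ≤ n := by exact_mod_cast hn
    linarith
  have h : HasSymbolicMoments P q m μ a f :=
    { memLp := fun φ => (hq.gaussian.hasGaussianLaw_eval φ).memLp_two
      order_nonneg := hm
      smooth := ha.smooth
      estimates := ha.estimates
      principal := hp
      covariance_symbol := hcov
      strength_smooth := hq_iso.strength_smooth
      mean_smooth := hf
      mean := hmean }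
  -- The cutoff equals 1 on the support of `μ`, so it disappears from the limit.
  have hχμ : ∀ x, ((χ x : ℝ) : ℂ) * ((χ x : ℝ) : ℂ) * ((μ x : ℝ) : ℂ) = ((μ x : ℝ) : ℂ) := by
    intro x
    by_cases hx : x ∈ tsupport μ
    · rw [hχ x (hq_iso.strength_support hx)]
      simp
    · rw [image_eq_zero_of_notMem_tsupport hx]
      simp
  set M : ℂ := ∫ x, expWave ((2 * (0 - τ)) • θ) x * ((μ x : ℝ) : ℂ) with hM
  have hav := fun κ κ' => ae_tendsto_average_waveTest hq h χ κ κ' hθ le_rfl hτ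
  simp only [hχμ] at hav
  have hc := fun κ d => ae_continuous_waveTest hq χ κ θ d
  filter_upwards [hav 1 1, hav (-Complex.I) (-Complex.I), hav (-Complex.I) 1, hav 1 (-Complex.I),
    hc 1 0, hc 1 τ, hc (-Complex.I) 0, hc (-Complex.I) τ] with ω l1 l2 l3 l4 c1 c2 c3 c4
  have hpc : Continuous fun k : ℝ => k ^ m := Real.continuous_rpow_const hm
  have hd : ∀ {u v : ℝ → ℝ}, Continuous u → Continuous v →
      Continuous fun k : ℝ => ((k ^ m * (u k * v k) : ℝ) : ℂ) := fun hu hv =>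
    Complex.continuous_ofReal.comp (hpc.mul (hu.mul hv))
  have d1 := hd c1 c2
  have d2 := hd c3 c4
  have d3 := hd c3 c2
  have d4 := hd c1 c4
  rw [funext (backscatteringCorrelation_eq c (q ω) χ m τ θ)]
  refine ⟨fun K _ => (continuous_const.mul ((d1.add d2).add
    (continuous_const.mul (d3.sub d4)))).intervalIntegrable _ _, ?_⟩
  have o1 := (Complex.continuous_ofReal.tendsto _).comp l1
  have o2 := (Complex.continuous_ofReal.tendsto _).comp l2
  have o3 := (Complex.continuous_ofReal.tendsto _).comp l3
  have o4 := (Complex.continuous_ofReal.tendsto _).comp l4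
  have hlim := ((o1.add o2).add ((o3.sub o4).const_mul Complex.I)).const_mul
    ((‖c‖ ^ 2 : ℝ) : ℂ)
  rw [backscatteringConst_mul_unitaryFourier, ← hM]
  convert hlim using 1
  · ext K
    have i1 := d1.intervalIntegrable (μ := volume) K (2 * K)
    have i2 := d2.intervalIntegrable (μ := volume) K (2 * K)
    have i3 := d3.intervalIntegrable (μ := volume) K (2 * K)
    have i4 := d4.intervalIntegrable (μ := volume) K (2 * K)
    rw [intervalIntegral.integral_const_mul, intervalIntegral.integral_add (i1.add i2)
      ((i3.sub i4).const_mul Complex.I), intervalIntegral.integral_add i1 i2,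
      intervalIntegral.integral_const_mul, intervalIntegral.integral_sub i3 i4]
    simp only [Function.comp_apply, intervalIntegral.integral_ofReal]
    push_cast
    ring
  · congr 1
    -- Each product contributes with weight `1/2`. The cosine-cosine and sine-sine terms both give
    -- `Re M`, the mixed terms give `±Im M` and are subtracted, so the total is `Re M + i Im M`.
    have r1 : (1 * (starRingEnd ℂ) 1 * M).re = M.re := by simp
    have r2 : (-Complex.I * (starRingEnd ℂ) (-Complex.I) * M).re = M.re := by simp
    have r3 : (-Complex.I * (starRingEnd ℂ) 1 * M).re = M.im := by simp
    have r4 : (1 * (starRingEnd ℂ) (-Complex.I) * M).re = -M.im := by simp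
    rw [r1, r2, r3, r4]
    conv_lhs => rw [← Complex.re_add_im M]
    push_cast
    ring
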